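/- Let $\kappa>0$ be real, $\alpha=1/\kappa$, and let $\zeta_\kappa(s)=\sum_{n\ge 1}\lfloor n^\kappa\rfloor^{-s}$ for $\Re(s)>\alpha$. Write $E_0(z)=1-z$ and $E_h(z)=(1-z)\exp\big(\sum_{1\le j\le h}z^j/j\big)$ for integers $h\ge 1$, $\widetilde B_1(x)=\{x\}-\tfrac12$, and ${\bf 1}_P$ for the indicator of a condition $P$. Let $\mathbb N$ be the set of positive integers, and let $\zeta$ be the Riemann zeta function. There is a real number $\sigma_\kappa\in(0,1]$ (depending only on $\kappa$) such that $\zeta_\kappa$ continues to a meromorphic function on $\Re(s)>-\sigma_\kappa$ whose only singularities there are simple poles at $s=\alpha,\alpha-1,\ldots,\alpha+1-\lceil\alpha\rceil$, with residues $$\operatorname*{Res}_{s=\alpha-h}\zeta_\kappa(s)=\frac{\Gamma(\alpha+1)}{(h+1)!\,\Gamma(\alpha-h)},\qquad h=0,1,\ldots,\lceil\alpha\rceil-1.$$ Furthermore, for every $\varepsilon>0$ there is a constant $C$ (depending only on $\varepsilon$ and $\kappa$) such that for all $s$ with $\Re(s)\ge\varepsilon-\sigma_\kappa$ and $|\Im(s)|\ge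 1$, $$|\zeta_\kappa(s)|\le C\,|s|\,(|s|+1)^{\lfloor\alpha\rfloor+1}.$$ Moreover, $$\zeta_\kappa(0)=-\frac{{\bf 1}_{\alpha\notin\mathbb N}}{2}-\frac{{\bf 1}_{\alpha\in\mathbb N}}{1+\kappa},$$ and $$\zeta_\kappa'(0)=\sum_{0\le h<\alpha}\binom{\alpha}{h}\zeta'(-h)\qquad\text{if }\alpha\in\mathbb N,$$ $$\zeta_\kappa'(0)=\sum_{1\le h\le\lceil\alpha\rceil}\frac{\zeta(h-\alpha)-1}{h}+\lim_{N\to\infty}\sum_{n=2}^{N}\log\left(\frac{E_0(1/n)^{\widetilde B_1(n^\alpha)+{\bf 1}_{n^\alpha\in\mathbb N}}}{E_{\lceil\alpha\rceil}(1/n)^{n^\alpha}}\right)\qquad\text{if }\alpha\notin\mathbb N,$$ where the limit exists. -/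

import Mathlib

/-- The Piatetski-Shapiro zeta series `∑_{n ≥ 1} ⌊n ^ κ⌋ ^ (-s)`, as the terms indexed by
`n = 0, 1, 2, …` with `n + 1` in place of `n`. -/
noncomputable def psZetaTerm (κ : ℝ) (s : ℂ) (n : ℕ) : ℂ :=
  1 / ((⌊((n + 1 : ℕ) : ℝ) ^ κ⌋₊ : ℕ) : ℂ) ^ s

/-- `Z` is a meromorphic function on the half-plane `Re s > -σ` that agrees with the
(absolutely convergent) Piatetski-Shapiro zeta series on `Re s > 1 / κ`. -/
structure IsPSZetaContinuation (κ σ : ℝ) (Z : ℂ → ℂ) : Prop where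
  meromorphicOn : MeromorphicOn Z {s : ℂ | -σ < s.re}
  hasSum : ∀ s : ℂ, 1 / κ < s.re → HasSum (psZetaTerm κ s) (Z s)

/-- `f` has a simple pole at `p`, with residue `r`. -/
structure HasSimplePoleWithResidue (f : ℂ → ℂ) (p r : ℂ) : Prop where
  meromorphicAt : MeromorphicAt f p
  order_eq : meromorphicOrderAt f p = -1
  tendsto : Filter.Tendsto (fun s : ℂ => (s - p) * f s) (nhdsWithin p {p}ᶜ) (nhds r)

/-- The canonical factor `E_h(z) = (1 - z) exp (∑_{1 ≤ j ≤ h} z ^ j / j)`; for `h = 0` the sum is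
empty and `E_0(z) = 1 - z`. -/
noncomputable def canonicalFactor (h : ℕ) (z : ℂ) : ℂ :=
  (1 - z) * Complex.exp (∑ j ∈ Finset.Icc 1 h, z ^ j / (j : ℂ))

/-- `B̃₁(x) = {x} - 1/2`. -/
noncomputable def bTilde (x : ℝ) : ℝ := Int.fract x - 1 / 2

/-- The indicator of the set of natural numbers inside `ℝ`. -/
noncomputable def natInd (x : ℝ) : ℝ :=
  Set.indicator (Set.range (fun m : ℕ => (m : ℝ))) (fun _ => (1 : ℝ)) x

/-- The `n`-th term of the series in the formula for the derivative at `0`: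
`log (E_0(1/n) ^ (B̃₁(n ^ α) + 1_{n ^ α ∈ ℕ}) / E_{⌈α⌉}(1/n) ^ (n ^ α))`. For `n ≥ 2` both
canonical factors are positive reals, so the powers and the logarithm are the usual real ones. -/
noncomputable def psLogTerm (α : ℝ) (n : ℕ) : ℂ :=
  Complex.log
    (canonicalFactor 0 (1 / (n : ℂ)) ^ ((bTilde ((n : ℝ) ^ α) + natInd ((n : ℝ) ^ α) : ℝ) : ℂ) /
      canonicalFactor ⌈α⌉₊ (1 / (n : ℂ)) ^ (((n : ℝ) ^ α : ℝ) : ℂ))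

/-!
With `α = 1 / κ`, the value `m` is taken by `⌊n ^ κ⌋` exactly `⌈(m + 1) ^ α⌉ - ⌈m ^ α⌉` times, so
the series is `∑ m ^ (-s) (⌈(m + 1) ^ α⌉ - ⌈m ^ α⌉)` (`sum_psZetaTerm`).

If `α = a` is an integer, the ceilings disappear, and the binomial theorem turns the series into the
finite sum `∑_{j < a} (a choose j) ζ(s - j)` (`binomialZeta`), from which everything is read off.

If `α` is not an integer, summation by parts and `⌈m ^ α⌉ = m ^ α + 1 / 2 + θ(m)`, where
`θ(m) = {-m ^ α} - 1 / 2` (`ceilDefect`), split the series into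
`-1 / 2 + ∑ m ^ α ((m - 1) ^ (-s) - m ^ (-s)) + ∑ θ(m) ((m - 1) ^ (-s) - m ^ (-s))`, with `m ≥ 2`.

* In the first series (`telescopeSum`), the expansion of `(m - 1) ^ (-s)` in powers of `1 / m` up to
  the order `k = ⌈α⌉` gives the terms `s (s + 1) ⋯ (s + h - 1) / h! * (ζ(s - α + h) - 1)`, which
  carry the poles and the residues, and a remainder that is holomorphic for `Re s > α - k`
  (`norm_taylorRem_le`). Each factor `s (s + 1) ⋯ (s + h - 1) / h!` has derivative `1 / h` at `0`.
* The second series converges beyond the line `Re s = 0` after one more summation by parts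
  (`ceilDefectSeries`), provided that `∑_{m ≤ x} θ(m) = O(x ^ (1 - σ))` for some `σ > 0`
  (`exists_sum_ceilDefect_le`). As `θ` is a sawtooth, it lies, up to a small error, between
  difference quotients of the periodic second Bernoulli function, whose Fourier series converges
  absolutely (`abs_sum_fract_neg_le`). This reduces the estimate to exponential sums over `j m ^ α`
  in dyadic blocks. There the `⌈α⌉`-th difference of the phase tends to `0` more slowly than
  `1 / m`, and `⌈α⌉ - 1` applications of the van der Corput inequality followed by the Kusmin-Landau
  inequality save a power (`norm_sum_expTwoPi_le`).

The polynomial growth of `ζ` itself comes from the same expansion with `α = 0`: the telescoping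
series is then equal to `1`, and this expresses `s ζ(s + 1)` through values of `ζ` further to the
right (`exists_norm_riemannZeta_le`).
-/

namespace PSZeta

open Finset Complex Filter

/-! ### Exponential sums and the van der Corput inequality -/

/-- The additive character `x ↦ exp (2πix)` of `ℝ / ℤ`. -/
noncomputable def expTwoPi (x : ℝ) : ℂ := Complex.exp (Complex.I * ((2 * Real.pi * x : ℝ) : ℂ))

lemma norm_expTwoPi (x : ℝ) : ‖expTwoPi x‖ = 1 := by
  rw [expTwoPi, mul_comm]; exact Complex.norm_exp_ofReal_mul_I _

lemma expTwoPi_add (x y : ℝ) : expTwoPi (x + y) = expTwoPi x * expTwoPi y := by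
  rw [expTwoPi, expTwoPi, expTwoPi, ← Complex.exp_add]; congr 1; push_cast; ring

lemma conj_expTwoPi (x : ℝ) : (starRingEnd ℂ) (expTwoPi x) = expTwoPi (-x) := by
  rw [expTwoPi, expTwoPi, ← Complex.exp_conj]
  congr 1
  rw [map_mul, Complex.conj_I, Complex.conj_ofReal]
  push_cast
  ring

lemma expTwoPi_sub (x y : ℝ) : expTwoPi (x - y) = expTwoPi x * (starRingEnd ℂ) (expTwoPi y) := by
  rw [conj_expTwoPi, sub_eq_add_neg, expTwoPi_add]

lemma expTwoPi_re (x : ℝ) : (expTwoPi x).re = Real.cos (2 * Real.pi * x) := by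
  rw [expTwoPi, mul_comm]; exact Complex.exp_ofReal_mul_I_re _

lemma norm_expTwoPi_sub_le (x y : ℝ) :
    ‖expTwoPi x - expTwoPi y‖ ≤ 2 * Real.pi * |x - y| := by
  have h : expTwoPi x - expTwoPi y = expTwoPi y * (expTwoPi (x - y) - 1) := by
    rw [mul_sub, mul_one, ← expTwoPi_add]; ring_nf
  rw [h, norm_mul, norm_expTwoPi, one_mul]
  refine (Real.norm_exp_I_mul_ofReal_sub_one_le).trans ?_
  rw [Real.norm_eq_abs, abs_mul, abs_of_pos Real.two_pi_pos]

lemma four_mul_le_norm_expTwoPi_sub_one {a : ℝ} (h0 : 0 ≤ a) (h1 : a ≤ 1 / 2) :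
    4 * a ≤ ‖expTwoPi a - 1‖ := by
  have hpi := Real.pi_pos
  rw [expTwoPi, Complex.norm_exp_I_mul_ofReal_sub_one]
  have h := Real.mul_le_sin (x := 2 * Real.pi * a / 2) (by positivity) (by nlinarith)
  rw [Real.norm_eq_abs]
  refine le_trans ?_ (le_abs_self _)
  have : 2 / Real.pi * (2 * Real.pi * a / 2) = 2 * a := by field_simp
  linarith

/-- The translate by `i` of the restriction of `z` to `[0, L)`, extended by zero. -/
noncomputable def shiftTrunc (z : ℕ → ℂ) (L i m : ℕ) : ℂ :=
  if i ≤ m ∧ m < i + L then z (m - i) else 0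

lemma sum_shiftTrunc (z : ℕ → ℂ) (L H i : ℕ) (hi : i < H) :
    ∑ m ∈ range (L + H), shiftTrunc z L i m = ∑ n ∈ range L, z n := by
  simp only [shiftTrunc]
  rw [← sum_filter]
  have : (range (L + H)).filter (fun m => i ≤ m ∧ m < i + L) = Ico i (i + L) := by
    ext m; simp only [mem_filter, mem_range, mem_Ico]; omega
  rw [this, sum_Ico_eq_sum_range]
  simp

lemma sum_shiftTrunc_mul_conj (z : ℕ → ℂ) (L H i j : ℕ) (hij : i ≤ j) (hj : j < H) :
    ∑ m ∈ range (L + H), shiftTrunc z L i m * (starRingEnd ℂ) (shiftTrunc z L j m) =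
      ∑ n ∈ range (L - (j - i)), z (n + (j - i)) * (starRingEnd ℂ) (z n) := by
  have h1 : ∀ m, shiftTrunc z L i m * (starRingEnd ℂ) (shiftTrunc z L j m) =
      if j ≤ m ∧ m < i + L then z (m - i) * (starRingEnd ℂ) (z (m - j)) else 0 := by
    intro m
    simp only [shiftTrunc]
    by_cases h : j ≤ m ∧ m < i + L
    · rw [if_pos h, if_pos ⟨by omega, by omega⟩, if_pos ⟨by omega, by omega⟩]
    · rw [if_neg h]
      by_cases h2 : i ≤ m ∧ m < i + L
      · rw [if_neg (c := j ≤ m ∧ m < j + L) (by omega)]; simp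
      · rw [if_neg h2]; simp
  simp only [h1]
  rw [← sum_filter]
  have : (range (L + H)).filter (fun m => j ≤ m ∧ m < i + L) = Ico j (i + L) := by
    ext m; simp only [mem_filter, mem_range, mem_Ico]; omega
  rw [this, sum_Ico_eq_sum_range]
  have h3 : i + L - j = L - (j - i) := by omega
  rw [h3]
  refine sum_congr rfl fun n _ => ?_
  rw [show j + n - i = n + (j - i) by omega, show j + n - j = n by omega]

/-- The van der Corput inequality: a bound for the correlations of a bounded sequence with its
shifts bounds the sum of the sequence. -/
lemma van_der_corput {z : ℕ → ℂ} (hz : ∀ n, ‖z n‖ ≤ 1) {L M H : ℕ} (hH : 1 ≤ H) (hL : L ≤ M)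
    (hHM : H ≤ M) {B : ℝ} (hB0 : 0 ≤ B)
    (hB : ∀ h, 1 ≤ h → h < H →
      ‖∑ n ∈ range (L - h), z (n + h) * (starRingEnd ℂ) (z n)‖ ≤ B) :
    ‖∑ n ∈ range L, z n‖ ^ 2 ≤ 2 * (M : ℝ) ^ 2 / H + 2 * M * B := by
  set S := ∑ n ∈ range L, z n with hS
  set w := shiftTrunc z L with hw
  have hLR : (L : ℝ) ≤ M := by exact_mod_cast hL
  have hHR : (H : ℝ) ≤ M := by exact_mod_cast hHM
  have hH1 : (1 : ℝ) ≤ H := by exact_mod_cast hH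
  have key1 : (H : ℂ) * S = ∑ m ∈ range (L + H), ∑ i ∈ range H, w i m := by
    rw [sum_comm, sum_congr rfl fun i hi => sum_shiftTrunc z L H i (mem_range.1 hi)]
    simp [hS]
  have corr : ∀ i ∈ range H, ∀ j ∈ range H,
      ‖∑ m ∈ range (L + H), w i m * (starRingEnd ℂ) (w j m)‖ ≤
        (if i = j then (L : ℝ) else 0) + B := by
    intro i hi j hj
    rw [mem_range] at hi hj
    rcases lt_trichotomy i j with h | h | h
    · rw [sum_shiftTrunc_mul_conj z L H i j h.le hj, if_neg h.ne, zero_add]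
      exact hB _ (by omega) (by omega)
    · subst h
      rw [sum_shiftTrunc_mul_conj z L H i i le_rfl hj, if_pos rfl]
      refine (norm_sum_le _ _).trans ?_
      refine (sum_le_card_nsmul _ _ 1 fun n _ => ?_).trans ?_
      · rw [norm_mul, RCLike.norm_conj]
        exact mul_le_one₀ (hz _) (norm_nonneg _) (hz _)
      · simp [hB0]
    · have hc : ∑ m ∈ range (L + H), w i m * (starRingEnd ℂ) (w j m) =
          (starRingEnd ℂ) (∑ m ∈ range (L + H), w j m * (starRingEnd ℂ) (w i m)) := by
        rw [map_sum]; refine sum_congr rfl fun m _ => ?_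
        simp [mul_comm]
      rw [hc, RCLike.norm_conj, sum_shiftTrunc_mul_conj z L H j i h.le hi, if_neg h.ne', zero_add]
      exact hB _ (by omega) (by omega)
  have key2 : ∑ m ∈ range (L + H), ‖∑ i ∈ range H, w i m‖ ^ 2 ≤ H * L + H ^ 2 * B := by
    have h1 : ((∑ m ∈ range (L + H), ‖∑ i ∈ range H, w i m‖ ^ 2 : ℝ) : ℂ) =
        ∑ i ∈ range H, ∑ j ∈ range H,
          ∑ m ∈ range (L + H), w i m * (starRingEnd ℂ) (w j m) := by
      push_cast
      have : ∀ i ∈ range H, ∑ j ∈ range H,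
          ∑ m ∈ range (L + H), w i m * (starRingEnd ℂ) (w j m) =
          ∑ m ∈ range (L + H), ∑ j ∈ range H, w i m * (starRingEnd ℂ) (w j m) :=
        fun i _ => sum_comm
      rw [sum_congr rfl this, sum_comm]
      refine sum_congr rfl fun m _ => ?_
      rw [← Complex.mul_conj', map_sum, sum_mul_sum]
    have h2 : ∑ m ∈ range (L + H), ‖∑ i ∈ range H, w i m‖ ^ 2 =
        ‖((∑ m ∈ range (L + H), ‖∑ i ∈ range H, w i m‖ ^ 2 : ℝ) : ℂ)‖ := by
      rw [Complex.norm_real, Real.norm_eq_abs, abs_of_nonneg]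
      exact sum_nonneg fun _ _ => by positivity
    rw [h2, h1]
    refine (norm_sum_le _ _).trans ?_
    have h3 : ∀ i ∈ range H, ‖∑ j ∈ range H,
        ∑ m ∈ range (L + H), w i m * (starRingEnd ℂ) (w j m)‖ ≤ L + H * B := by
      intro i hi
      refine (norm_sum_le _ _).trans ((sum_le_sum (corr i hi)).trans ?_)
      rw [sum_add_distrib, sum_ite_eq, if_pos hi]
      simp
    refine (sum_le_sum h3).trans ?_
    simp only [sum_const, card_range, nsmul_eq_mul]
    nlinarith
  have key3 : ((H : ℝ) * ‖S‖) ^ 2 ≤ (L + H) * (H * L + H ^ 2 * B) := by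
    have h1 : (H : ℝ) * ‖S‖ ≤ ∑ m ∈ range (L + H), ‖∑ i ∈ range H, w i m‖ := by
      have : (H : ℝ) * ‖S‖ = ‖(H : ℂ) * S‖ := by simp
      rw [this, key1]; exact norm_sum_le _ _
    calc ((H : ℝ) * ‖S‖) ^ 2 ≤ (∑ m ∈ range (L + H), ‖∑ i ∈ range H, w i m‖) ^ 2 := by gcongr
      _ ≤ (L + H) * ∑ m ∈ range (L + H), ‖∑ i ∈ range H, w i m‖ ^ 2 := by
        have := sq_sum_le_card_mul_sum_sq (s := range (L + H))
          (f := fun m => ‖∑ i ∈ range H, w i m‖)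
        simpa using this
      _ ≤ _ := by gcongr
  have key4 : ((H : ℝ) * ‖S‖) ^ 2 ≤ (2 * M) * (H * M + H ^ 2 * B) := by
    refine key3.trans ?_
    gcongr
    linarith
  have hHp : (0 : ℝ) < H := by linarith
  have : ‖S‖ ^ 2 = ((H : ℝ) * ‖S‖) ^ 2 / H ^ 2 := by field_simp
  rw [this, div_le_iff₀ (by positivity)]
  refine key4.trans (le_of_eq ?_)
  field_simp

/-- The Kusmin-Landau inequality: the exponential sum of a sequence whose successive
differences are monotone and bounded away from the integers exhibits cancellation. -/
lemma kusmin_landau {g : ℕ → ℝ} {lam : ℝ} (hlam : 0 < lam) {L : ℕ}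
    (hlow : ∀ n < L, lam ≤ g (n + 1) - g n)
    (hanti : ∀ n, g (n + 2) - g (n + 1) ≤ g (n + 1) - g n)
    (hup : ∀ n, g (n + 1) - g n ≤ 1 / 2) :
    ‖∑ n ∈ range L, expTwoPi (g n)‖ ≤ 1 / lam := by
  rcases Nat.eq_zero_or_pos L with rfl | hLpos
  · simp [hlam.le]
  obtain ⟨K, rfl⟩ : ∃ K, L = K + 1 := ⟨L - 1, by omega⟩
  set a : ℕ → ℝ := fun n => g (n + 1) - g n with ha
  set c : ℕ → ℂ := fun n => (expTwoPi (a n) - 1)⁻¹ with hc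
  have hapos : ∀ n < K + 1, 0 < a n := fun n hn => hlam.trans_le (hlow n hn)
  have hnorm : ∀ n < K + 1, 4 * a n ≤ ‖expTwoPi (a n) - 1‖ := fun n hn =>
    four_mul_le_norm_expTwoPi_sub_one (hapos n hn).le (hup n)
  have hne : ∀ n < K + 1, expTwoPi (a n) - 1 ≠ 0 := fun n hn h => by
    have := hnorm n hn; rw [h, norm_zero] at this; linarith [hapos n hn]
  have hcn : ∀ n < K + 1, ‖c n‖ ≤ 1 / (4 * lam) := by
    intro n hn
    rw [hc, norm_inv, one_div]
    refine inv_anti₀ (by positivity)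
      ((by linarith [hlow n hn] : 4 * lam ≤ 4 * a n).trans (hnorm n hn))
  have hcd : ∀ n < K, ‖c n - c (n + 1)‖ ≤ Real.pi / 8 * (1 / a (n + 1) - 1 / a n) := by
    intro n hn
    have h1 := hapos n (by omega)
    have h2 := hapos (n + 1) (by omega)
    have e1 := hne n (by omega)
    have e2 := hne (n + 1) (by omega)
    have hd : c n - c (n + 1) = (expTwoPi (a (n + 1)) - expTwoPi (a n)) /
        ((expTwoPi (a n) - 1) * (expTwoPi (a (n + 1)) - 1)) := by
      simp only [hc]; field_simp; ring
    rw [hd, norm_div, norm_mul]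
    have hle : a (n + 1) ≤ a n := hanti n
    have : Real.pi / 8 * (1 / a (n + 1) - 1 / a n) =
        (2 * Real.pi * (a n - a (n + 1))) / ((4 * a n) * (4 * a (n + 1))) := by
      field_simp; ring
    rw [this]
    have hpi := Real.pi_pos
    refine div_le_div₀ (by have := sub_nonneg.2 hle; positivity) ?_ (by positivity) ?_
    · refine (norm_expTwoPi_sub_le _ _).trans ?_
      rw [abs_sub_comm, abs_of_nonneg (sub_nonneg.2 hle)]
    · exact mul_le_mul (hnorm n (by omega)) (hnorm _ (by omega)) (by positivity) (norm_nonneg _)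
  -- Abel summation, using `e(g n) = c n * (e(g (n + 1)) - e(g n))`
  have habel : ∀ J ≤ K, ∑ n ∈ range (J + 1), expTwoPi (g n) =
      c J * expTwoPi (g (J + 1)) - c 0 * expTwoPi (g 0) +
        ∑ n ∈ range J, expTwoPi (g (n + 1)) * (c n - c (n + 1)) := by
    have hstep : ∀ n < K + 1, expTwoPi (g n) = c n * (expTwoPi (g (n + 1)) - expTwoPi (g n)) := by
      intro n hn
      have e1 := hne n hn
      have : expTwoPi (g (n + 1)) = expTwoPi (a n) * expTwoPi (g n) := by
        rw [← expTwoPi_add]; simp [ha]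
      rw [this]; simp only [hc]; field_simp
    intro J
    induction J with
    | zero =>
      intro _
      simp only [zero_add, sum_range_one, range_zero, sum_empty]
      linear_combination hstep 0 (by omega)
    | succ J ih =>
      intro hJ
      rw [sum_range_succ, ih (by omega), sum_range_succ]
      have := hstep (J + 1) (by omega)
      linear_combination this
  rw [habel K le_rfl]
  have hsum : ∑ n ∈ range K, ‖expTwoPi (g (n + 1)) * (c n - c (n + 1))‖ ≤
      Real.pi / 8 * (1 / lam) := by
    have h1 : ∑ n ∈ range K, ‖expTwoPi (g (n + 1)) * (c n - c (n + 1))‖ ≤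
        ∑ n ∈ range K, Real.pi / 8 * (1 / a (n + 1) - 1 / a n) := by
      refine sum_le_sum fun n hn => ?_
      rw [norm_mul, norm_expTwoPi, one_mul]; exact hcd n (mem_range.1 hn)
    refine h1.trans ?_
    rw [← mul_sum, sum_range_sub (fun n => 1 / a n)]
    have h2 : 1 / a K ≤ 1 / lam := one_div_le_one_div_of_le hlam (hlow K (by omega))
    have h3 : 0 < 1 / a 0 := one_div_pos.2 (hapos 0 (by omega))
    have := Real.pi_pos
    gcongr
    linarith
  calc _ ≤ ‖c K * expTwoPi (g (K + 1)) - c 0 * expTwoPi (g 0)‖ +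
        ‖∑ n ∈ range K, expTwoPi (g (n + 1)) * (c n - c (n + 1))‖ := norm_add_le _ _
    _ ≤ (1 / (4 * lam) + 1 / (4 * lam)) + Real.pi / 8 * (1 / lam) := by
      gcongr
      · refine (norm_sub_le _ _).trans ?_
        rw [norm_mul, norm_mul, norm_expTwoPi, norm_expTwoPi, mul_one, mul_one]
        exact add_le_add (hcn K (by omega)) (hcn 0 (by omega))
      · exact (norm_sum_le _ _).trans hsum
    _ ≤ 1 / lam := by
      have h4 : 1 / (4 * lam) = (1 / 4) * (1 / lam) := by field_simp
      have h5 : 0 < 1 / lam := by positivity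
      have h6 := Real.pi_le_four
      rw [h4]; nlinarith

/-! ### Iterated differences of powers -/

lemma fwdDiff_iter_shift_sub (f : ℕ → ℝ) (h k n : ℕ) :
    (fwdDiff 1)^[k] (fun n => f (n + h) - f n) n =
      (fwdDiff 1)^[k] f (n + h) - (fwdDiff 1)^[k] f n := by
  induction k generalizing n with
  | zero => rfl
  | succ k ih =>
    simp only [Function.iterate_succ_apply', fwdDiff, ih]
    rw [show n + 1 + h = n + h + 1 by ring]
    ring

lemma fwdDiff_iter_comp_add_natCast (F : ℝ → ℝ) (N k n : ℕ) :
    (fwdDiff 1)^[k] (fun n : ℕ => F ((N + n : ℕ) : ℝ)) n = (fwdDiff 1)^[k] F ((N + n : ℕ) : ℝ) := by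
  induction k generalizing n with
  | zero => rfl
  | succ k ih =>
    simp only [Function.iterate_succ_apply', fwdDiff, ih]
    rw [show N + (n + 1) = N + n + 1 by ring]
    push_cast
    ring_nf

/-- The `k`-th difference of a constant multiple is the multiple of the `k`-th difference. -/
lemma fwdDiff_iter_mul {M : Type*} [AddCommMonoid M] (h : M) (c : ℝ) (f : M → ℝ) (k : ℕ) (x : M) :
    (fwdDiff h)^[k] (fun t => c * f t) x = c * (fwdDiff h)^[k] f x := by
  induction k generalizing x with
  | zero => rfl
  | succ k ih =>
    simp only [Function.iterate_succ_apply', fwdDiff, ih]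
    ring

lemma hasDerivAt_fwdDiff_iter {F F' : ℝ → ℝ} (hF : ∀ x, 0 < x → HasDerivAt F (F' x) x) (k : ℕ)
    {x : ℝ} (hx : 0 < x) : HasDerivAt ((fwdDiff 1)^[k] F) ((fwdDiff 1)^[k] F' x) x := by
  induction k generalizing x with
  | zero => exact hF x hx
  | succ k ih =>
    simp only [Function.iterate_succ_apply']
    exact ((ih (by linarith : 0 < x + 1)).comp_add_const x 1).sub (ih hx)

/-- The mean value theorem for the iterated differences of a power function. -/
lemma exists_fwdDiff_iter_rpow (β : ℝ) (k : ℕ) {x : ℝ} (hx : 0 < x) :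
    ∃ ξ, x ≤ ξ ∧ ξ ≤ x + k ∧
      (fwdDiff 1)^[k] (fun t : ℝ => t ^ β) x = (∏ i ∈ range k, (β - i)) * ξ ^ (β - k) := by
  induction k generalizing β x with
  | zero => exact ⟨x, le_rfl, by simp, by simp⟩
  | succ k ih =>
    have hd : ∀ y, 0 < y → HasDerivAt ((fwdDiff 1)^[k] (fun t : ℝ => t ^ β))
        (β * (fwdDiff 1)^[k] (fun t : ℝ => t ^ (β - 1)) y) y := by
      intro y hy
      rw [← fwdDiff_iter_mul]
      exact hasDerivAt_fwdDiff_iter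
        (fun z hz => Real.hasDerivAt_rpow_const (Or.inl hz.ne')) k hy
    obtain ⟨η, ⟨hη1, hη2⟩, hη⟩ := exists_hasDerivAt_eq_slope
      ((fwdDiff 1)^[k] (fun t : ℝ => t ^ β)) _
      (by linarith : x < x + 1)
      (fun y hy => (hd y (hx.trans_le hy.1)).continuousAt.continuousWithinAt)
      (fun y hy => hd y (hx.trans hy.1))
    obtain ⟨ξ, h1, h2, h3⟩ := ih (β - 1) (hx.trans hη1)
    refine ⟨ξ, by linarith, by push_cast; linarith, ?_⟩
    rw [Function.iterate_succ_apply', fwdDiff]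
    rw [add_sub_cancel_left, div_one] at hη
    rw [← hη, h3, prod_range_succ']
    have e1 : ∀ i : ℕ, β - 1 - i = β - ((i + 1 : ℕ) : ℝ) := fun i => by push_cast; ring
    simp only [e1]
    push_cast
    ring

/-! ### Exponential sums over sequences with a controlled iterated difference -/

/-- A `k`-th derivative test for exponential sums, by induction on `k`: the van der Corput
inequality lowers the order of the difference, and the Kusmin-Landau inequality starts the
induction. -/
lemma norm_sum_expTwoPi_le (k : ℕ) : ∀ (f : ℕ → ℝ) (L H M : ℕ) (lam U X : ℝ), 0 < lam →
    (∀ n < L, lam ≤ (fwdDiff 1)^[k + 1] f n) →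
    (∀ n, (fwdDiff 1)^[k + 1] f (n + 1) ≤ (fwdDiff 1)^[k + 1] f n) →
    (∀ n, (fwdDiff 1)^[k + 1] f n ≤ U) → U * (H : ℝ) ^ k ≤ 1 / 2 → 1 ≤ X → X ≤ H → X ≤ lam * M →
    L ≤ M → H ≤ M →
    ‖∑ n ∈ range L, expTwoPi (f n)‖ ≤ 6 * M * X ^ (-(1 / 2 : ℝ) ^ k) := by
  induction k with
  | zero =>
    intro f L H M lam U X hlam hlow hanti hup hU hX hXH hXM hLM hHM
    simp only [zero_add, Function.iterate_one, fwdDiff, pow_zero, mul_one] at hlow hanti hup hU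
    refine (kusmin_landau hlam hlow hanti fun n => (hup n).trans hU).trans ?_
    have hX0 : 0 < X := by linarith
    rw [pow_zero, Real.rpow_neg_one, ← div_eq_mul_inv, div_le_div_iff₀ hlam hX0]
    nlinarith
  | succ k ih =>
    intro f L H M lam U X hlam hlow hanti hup hU hX hXH hXM hLM hHM
    have hX0 : 0 < X := by linarith
    have hH1 : (1 : ℝ) ≤ H := hX.trans hXH
    have hH : 1 ≤ H := by exact_mod_cast hH1
    set Y : ℝ := X ^ (-(1 / 2 : ℝ) ^ k) with hY
    set Y' : ℝ := X ^ (-(1 / 2 : ℝ) ^ (k + 1)) with hY'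
    have hY0 : 0 < Y := Real.rpow_pos_of_pos hX0 _
    have hYY : Y' ^ 2 = Y := by
      rw [hY, hY', ← Real.rpow_natCast, ← Real.rpow_mul hX0.le]
      congr 1; push_cast; ring
    have hM0 : (0 : ℝ) ≤ M := Nat.cast_nonneg _
    have hB0 : 0 ≤ 6 * M * Y := by positivity
    have hdiff : ∀ h n, (fwdDiff 1)^[k + 1] (fun n => f (n + h) - f n) n =
        ∑ i ∈ range h, (fwdDiff 1)^[k + 1 + 1] f (n + i) := by
      intro h n
      rw [fwdDiff_iter_shift_sub]
      have := sum_range_sub (fun i => (fwdDiff 1)^[k + 1] f (n + i)) h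
      rw [add_zero] at this
      rw [← this]
      refine sum_congr rfl fun i _ => ?_
      rw [Function.iterate_succ_apply' _ (k + 1), fwdDiff]; rfl
    have hvdc := van_der_corput (z := fun n => expTwoPi (f n)) (fun n => (norm_expTwoPi _).le)
      hH hLM hHM hB0 (fun h h1 h2 => by
        have e1 : ∀ n, expTwoPi (f (n + h)) * (starRingEnd ℂ) (expTwoPi (f n)) =
            expTwoPi (f (n + h) - f n) := fun n => (expTwoPi_sub _ _).symm
        simp only [e1]
        have hhR : (1 : ℝ) ≤ h := by exact_mod_cast h1
        have hhH : (h : ℝ) ≤ H := by exact_mod_cast h2.le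
        have hU0 : 0 ≤ U ∨ L = 0 := by
          rcases Nat.eq_zero_or_pos L with h0 | h0
          · exact Or.inr h0
          · exact Or.inl (hlam.le.trans ((hlow 0 h0).trans (hup 0)))
        rcases hU0 with hU0 | rfl
        swap
        · simpa using hB0
        refine ih (fun n => f (n + h) - f n) (L - h) H M lam (H * U) X hlam ?_ ?_ ?_ ?_ hX hXH hXM
          (by omega) hHM
        · intro n hn
          rw [hdiff]
          have : ∑ i ∈ range h, lam ≤ ∑ i ∈ range h, (fwdDiff 1)^[k + 1 + 1] f (n + i) :=
            sum_le_sum fun i hi => hlow _ (by rw [mem_range] at hi; omega)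
          rw [sum_const, card_range, nsmul_eq_mul] at this
          nlinarith
        · intro n
          rw [hdiff, hdiff]
          refine sum_le_sum fun i _ => ?_
          rw [show n + 1 + i = n + i + 1 by ring]
          exact hanti _
        · intro n
          rw [hdiff]
          have : ∑ i ∈ range h, (fwdDiff 1)^[k + 1 + 1] f (n + i) ≤ ∑ i ∈ range h, U :=
            sum_le_sum fun i hi => hup _
          rw [sum_const, card_range, nsmul_eq_mul] at this
          exact this.trans (by gcongr)
        · calc (H : ℝ) * U * (H : ℝ) ^ k = U * (H : ℝ) ^ (k + 1) := by ring
            _ ≤ _ := hU)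
    have hXY : 1 / (H : ℝ) ≤ Y := by
      calc 1 / (H : ℝ) ≤ 1 / X := one_div_le_one_div_of_le hX0 hXH
        _ = X ^ (-1 : ℝ) := by rw [Real.rpow_neg_one, one_div]
        _ ≤ Y := Real.rpow_le_rpow_of_exponent_le hX
          (neg_le_neg (pow_le_one₀ (by norm_num) (by norm_num)))
    have h14 : ‖∑ n ∈ range L, expTwoPi (f n)‖ ^ 2 ≤ (6 * M * Y') ^ 2 := by
      refine hvdc.trans ?_
      have e2 : 2 * (M : ℝ) ^ 2 / H = 2 * (M : ℝ) ^ 2 * (1 / H) := by ring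
      have e3 : (6 * M * Y') ^ 2 = 36 * (M : ℝ) ^ 2 * Y := by rw [← hYY]; ring
      rw [e2, e3]
      have : 2 * (M : ℝ) ^ 2 * (1 / H) ≤ 2 * (M : ℝ) ^ 2 * Y := by gcongr
      have h0 : 0 ≤ (M : ℝ) ^ 2 * Y := by positivity
      nlinarith
    exact le_of_sq_le_sq h14 (by positivity)

/-! ### The sawtooth function along a sequence with small exponential sums -/

/-- The periodic extension of the second Bernoulli polynomial `x ^ 2 - x + 1 / 6`. -/
noncomputable def periodicBernoulliTwo (x : ℝ) : ℝ := Int.fract x ^ 2 - Int.fract x + 1 / 6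

lemma hasSum_periodicBernoulliTwo (x : ℝ) :
    HasSum (fun n : ℕ => 1 / (n : ℝ) ^ 2 * Real.cos (2 * Real.pi * (n * x)))
      (Real.pi ^ 2 * periodicBernoulliTwo x) := by
  have h := hasSum_one_div_nat_pow_mul_cos (k := 1) one_ne_zero (x := Int.fract x)
    ⟨Int.fract_nonneg x, (Int.fract_lt_one x).le⟩
  have e := bernoulliFun_two (Int.fract x)
  rw [bernoulliFun] at e
  simp only [mul_one] at h
  rw [e] at h
  convert h using 1
  · funext n
    congr 1
    have : 2 * Real.pi * (n * x) =
        2 * Real.pi * n * Int.fract x + (n * ⌊x⌋ : ℤ) * (2 * Real.pi) := by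
      conv_lhs => rw [← Int.floor_add_fract x]
      push_cast; ring
    rw [this, Real.cos_add_int_mul_two_pi]
  · rw [periodicBernoulliTwo]
    norm_num [Nat.factorial]
    field_simp
    simp

/-- The forward difference of `B₂` majorizes the sawtooth, since the sawtooth increases with slope
`1` between its downward jumps. -/
lemma periodicBernoulliTwo_add_sub_le (x : ℝ) {δ : ℝ} (h0 : 0 ≤ δ) (h1 : δ ≤ 1) :
    periodicBernoulliTwo (x + δ) - periodicBernoulliTwo x ≤
      2 * δ * (Int.fract x - 1 / 2) + δ ^ 2 := by
  have hu0 := Int.fract_nonneg x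
  have hu1 := Int.fract_lt_one x
  rw [periodicBernoulliTwo, periodicBernoulliTwo]
  rcases lt_or_ge (Int.fract x + δ) 1 with h | h
  · have : Int.fract (x + δ) = Int.fract x + δ :=
      Int.fract_eq_iff.2 ⟨by linarith, h, ⌊x⌋, by rw [Int.fract]; ring⟩
    rw [this]; nlinarith
  · have : Int.fract (x + δ) = Int.fract x + δ - 1 :=
      Int.fract_eq_iff.2 ⟨by linarith, by linarith, ⌊x⌋ + 1, by rw [Int.fract]; push_cast; ring⟩
    rw [this]; nlinarith

lemma le_periodicBernoulliTwo_sub_sub (x : ℝ) {δ : ℝ} (h0 : 0 ≤ δ) (h1 : δ ≤ 1) :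
    2 * δ * (Int.fract x - 1 / 2) - δ ^ 2 ≤
      periodicBernoulliTwo x - periodicBernoulliTwo (x - δ) := by
  have hu0 := Int.fract_nonneg x
  have hu1 := Int.fract_lt_one x
  rw [periodicBernoulliTwo, periodicBernoulliTwo]
  rcases le_or_gt 0 (Int.fract x - δ) with h | h
  · have : Int.fract (x - δ) = Int.fract x - δ :=
      Int.fract_eq_iff.2 ⟨h, by linarith, ⌊x⌋, by rw [Int.fract]; ring⟩
    rw [this]; nlinarith
  · have : Int.fract (x - δ) = Int.fract x - δ + 1 :=
      Int.fract_eq_iff.2 ⟨by linarith, by linarith, ⌊x⌋ - 1, by rw [Int.fract]; push_cast; ring⟩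
    rw [this]; nlinarith

lemma abs_sum_cos_le (x : ℕ → ℝ) (δ : ℝ) (L j : ℕ) :
    |∑ n ∈ range L, Real.cos (2 * Real.pi * (j * (δ - x n)))| ≤
      ‖∑ n ∈ range L, expTwoPi (j * x n)‖ := by
  have h : ((expTwoPi (j * δ) * (starRingEnd ℂ) (∑ n ∈ range L, expTwoPi (j * x n)))).re =
      ∑ n ∈ range L, Real.cos (2 * Real.pi * (j * (δ - x n))) := by
    rw [map_sum, mul_sum, Complex.re_sum]
    refine sum_congr rfl fun n _ => ?_
    rw [← expTwoPi_sub, expTwoPi_re, mul_sub (j : ℝ)]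
  rw [← h]
  refine (Complex.abs_re_le_norm _).trans ?_
  rw [norm_mul, norm_expTwoPi, one_mul, RCLike.norm_conj]

lemma abs_sum_periodicBernoulliTwo_le {x : ℕ → ℝ} {L M H : ℕ} (hLM : L ≤ M) (hH : 1 ≤ H) {B : ℝ}
    (hB0 : 0 ≤ B) (hB : ∀ j, 1 ≤ j → j ≤ H → ‖∑ n ∈ range L, expTwoPi (j * x n)‖ ≤ B) (δ : ℝ) :
    |∑ n ∈ range L, periodicBernoulliTwo (δ - x n)| ≤ B + (M : ℝ) / H := by
  have hs := hasSum_sum (s := range L) (fun n _ => hasSum_periodicBernoulliTwo (δ - x n))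
  rw [← mul_sum] at hs
  have hLR : (L : ℝ) ≤ M := by exact_mod_cast hLM
  have hHR : (1 : ℝ) ≤ H := by exact_mod_cast hH
  have hterm : ∀ j : ℕ, |∑ n ∈ range L, 1 / (j : ℝ) ^ 2 * Real.cos (2 * Real.pi * (j * (δ - x n)))|
      ≤ 1 / (j : ℝ) ^ 2 * ‖∑ n ∈ range L, expTwoPi (j * x n)‖ := by
    intro j
    rw [← mul_sum, abs_mul, abs_of_nonneg (by positivity)]
    gcongr
    exact abs_sum_cos_le x δ L j
  have hpart : ∀ J, H ≤ J → |∑ j ∈ range (J + 1),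
      ∑ n ∈ range L, 1 / (j : ℝ) ^ 2 * Real.cos (2 * Real.pi * (j * (δ - x n)))| ≤
        2 * B + (M : ℝ) / H := by
    intro J hJ
    have hsplit : range (J + 1) = insert 0 (Ioc 0 H ∪ Ioc H J) := by
      ext m; simp only [mem_range, mem_insert, mem_union, mem_Ioc]; omega
    have hdisj : Disjoint (Ioc 0 H) (Ioc H J) := by
      rw [disjoint_left]; intro m; simp only [mem_Ioc]; omega
    have h1 : ∑ j ∈ Ioc 0 H, 1 / (j : ℝ) ^ 2 * ‖∑ n ∈ range L, expTwoPi (j * x n)‖ ≤ 2 * B := by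
      have h2 : ∑ j ∈ Ioc 0 H, 1 / (j : ℝ) ^ 2 ≤ 2 := by
        have e : Ioc 0 H = insert 1 (Ioc 1 H) := by
          ext m; simp only [mem_insert, mem_Ioc]; omega
        rw [e, sum_insert (by simp)]
        have h3 := sum_Ioc_inv_sq_le_sub (α := ℝ) one_ne_zero hH
        have h4 : (0 : ℝ) ≤ (H : ℝ)⁻¹ := by positivity
        simp only [one_div]
        norm_num at h3 ⊢
        linarith
      calc _ ≤ ∑ j ∈ Ioc 0 H, 1 / (j : ℝ) ^ 2 * B := by
            refine sum_le_sum fun j hj => ?_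
            rw [mem_Ioc] at hj
            gcongr
            exact hB j hj.1 hj.2
        _ ≤ _ := by rw [← sum_mul]; gcongr
    have h2 : ∑ j ∈ Ioc H J, 1 / (j : ℝ) ^ 2 * ‖∑ n ∈ range L, expTwoPi (j * x n)‖ ≤
        (M : ℝ) / H := by
      have h3 := sum_Ioc_inv_sq_le_sub (α := ℝ) (by omega : H ≠ 0) hJ
      have h4 : (0 : ℝ) ≤ (J : ℝ)⁻¹ := by positivity
      calc _ ≤ ∑ j ∈ Ioc H J, ((j : ℝ) ^ 2)⁻¹ * M := by
            refine sum_le_sum fun j hj => ?_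
            rw [one_div]
            gcongr
            refine (norm_sum_le _ _).trans ?_
            simpa [norm_expTwoPi] using hLR
        _ ≤ (H : ℝ)⁻¹ * M := by rw [← sum_mul]; gcongr; linarith
        _ = _ := by ring
    refine (abs_sum_le_sum_abs _ _).trans ((sum_le_sum fun j _ => hterm j).trans ?_)
    rw [hsplit, sum_insert (by simp), sum_union hdisj]
    simp only [CharP.cast_eq_zero, ne_eq, OfNat.ofNat_ne_zero, not_false_eq_true, zero_pow, div_zero,
      zero_mul, zero_add]
    linarith
  have hlim := (hs.tendsto_sum_nat.comp (Filter.tendsto_add_atTop_nat 1)).abs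
  have hle := le_of_tendsto hlim (Filter.eventually_atTop.2 ⟨H, fun J hJ => hpart J hJ⟩)
  rw [abs_mul, abs_of_nonneg (by positivity)] at hle
  have hpi : (2 : ℝ) ≤ Real.pi ^ 2 := by nlinarith [Real.pi_gt_three]
  have hM : (0 : ℝ) ≤ (M : ℝ) / H := by positivity
  have := abs_nonneg (∑ n ∈ range L, periodicBernoulliTwo (δ - x n))
  nlinarith

/-- Cancellation in exponential sums gives cancellation in sums of the sawtooth function: sandwich
the sawtooth between difference quotients of `B₂`. -/
lemma abs_sum_fract_neg_le {x : ℕ → ℝ} {L M : ℕ} (hLM : L ≤ M) {D δ : ℝ} (hδ0 : 0 < δ)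
    (hδ1 : δ ≤ 1) (hD : ∀ y, |∑ n ∈ range L, periodicBernoulliTwo (y - x n)| ≤ M * D) :
    |∑ n ∈ range L, (Int.fract (-x n) - 1 / 2)| ≤ M * (D / δ + δ / 2) := by
  have hLR : (L : ℝ) ≤ M := by exact_mod_cast hLM
  have h1 : ∑ n ∈ range L, periodicBernoulliTwo (δ - x n) -
      ∑ n ∈ range L, periodicBernoulliTwo (0 - x n) ≤
        2 * δ * ∑ n ∈ range L, (Int.fract (-x n) - 1 / 2) + L * δ ^ 2 := by
    rw [← sum_sub_distrib, mul_sum]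
    have : (L : ℝ) * δ ^ 2 = ∑ n ∈ range L, δ ^ 2 := by simp
    rw [this, ← sum_add_distrib]
    refine sum_le_sum fun n _ => ?_
    have := periodicBernoulliTwo_add_sub_le (-x n) hδ0.le hδ1
    rw [zero_sub]
    rwa [neg_add_eq_sub] at this
  have h2 : 2 * δ * ∑ n ∈ range L, (Int.fract (-x n) - 1 / 2) - L * δ ^ 2 ≤
      ∑ n ∈ range L, periodicBernoulliTwo (0 - x n) -
      ∑ n ∈ range L, periodicBernoulliTwo (-δ - x n) := by
    rw [← sum_sub_distrib, mul_sum]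
    have : (L : ℝ) * δ ^ 2 = ∑ n ∈ range L, δ ^ 2 := by simp
    rw [this, ← sum_sub_distrib]
    refine sum_le_sum fun n _ => ?_
    have := le_periodicBernoulliTwo_sub_sub (-x n) hδ0.le hδ1
    rw [zero_sub]
    rwa [show -x n - δ = -δ - x n by ring] at this
  have a1 := abs_le.1 (hD δ)
  have a2 := abs_le.1 (hD 0)
  have a3 := abs_le.1 (hD (-δ))
  have h3 : (L : ℝ) * δ ^ 2 ≤ M * δ ^ 2 := by gcongr
  have h4 : |2 * δ * ∑ n ∈ range L, (Int.fract (-x n) - 1 / 2)| ≤ 2 * (M * D) + M * δ ^ 2 :=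
    abs_le.2 ⟨by linarith [a1.1, a2.2], by linarith [a2.2, a3.1]⟩
  rw [abs_mul, abs_of_pos (by positivity)] at h4
  have h5 : M * (D / δ + δ / 2) = (2 * (M * D) + M * δ ^ 2) / (2 * δ) := by field_simp
  rw [h5, le_div_iff₀ (by positivity)]
  linarith

/-! ### Power-saving cancellation of the sawtooth along `n ^ α` -/

/-- Exponential sums over `j * m ^ α` in dyadic blocks, for `α` strictly between `k` and `k + 1`.
The order `k + 1` of the difference is the one for which it is small, but of larger order
than `1 / N`. -/
lemma eventually_norm_sum_expTwoPi_rpow_le {α : ℝ} {k : ℕ} (h1 : (k : ℝ) < α) (h2 : α < k + 1) :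
    ∃ η : ℝ, 0 < η ∧ η < 1 ∧ ∀ᶠ N : ℕ in atTop, ∀ L ≤ N, ∀ j : ℕ, 1 ≤ j →
      j ≤ ⌊(N : ℝ) ^ η⌋₊ →
      ‖∑ n ∈ range L, expTwoPi (j * ((N + n : ℕ) : ℝ) ^ α)‖ ≤
        6 * N * (⌊(N : ℝ) ^ η⌋₊ : ℝ) ^ (-(1 / 2 : ℝ) ^ k) := by
  set ρ : ℝ := k + 1 - α with hρ
  have hρ0 : 0 < ρ := by linarith
  have hρ1 : ρ < 1 := by linarith
  have hk0 : (0 : ℝ) ≤ k := Nat.cast_nonneg _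
  set η : ℝ := ρ * (1 - ρ) / (k + 2) with hη
  have hη0 : 0 < η := by
    have : 0 < 1 - ρ := by linarith
    positivity
  have hηk : η * (k + 2) = ρ * (1 - ρ) := by rw [hη]; field_simp
  have hη1 : η * (k + 1) < ρ := by nlinarith
  have hη2 : η < 1 - ρ := by nlinarith
  set P : ℝ := ∏ i ∈ range (k + 1), (α - i) with hP
  have hP0 : 0 < P := prod_pos fun i hi => by
    have : (i : ℝ) ≤ k := by exact_mod_cast Nat.lt_succ_iff.1 (mem_range.1 hi)
    linarith
  refine ⟨η, hη0, by linarith, ?_⟩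
  have ev1 : ∀ᶠ N : ℕ in atTop, P * (N : ℝ) ^ (-(ρ - η * (k + 1))) ≤ 1 / 2 := by
    have := ((tendsto_rpow_neg_atTop (y := ρ - η * (k + 1)) (by linarith)).comp
      tendsto_natCast_atTop_atTop).const_mul P
    rw [mul_zero] at this
    exact this.eventually_le_const (by norm_num)
  have ev2 : ∀ᶠ N : ℕ in atTop, (N : ℝ) ^ (-(1 - ρ - η)) ≤ P * 3 ^ (-ρ) := by
    have := ((tendsto_rpow_neg_atTop (y := 1 - ρ - η) (by linarith)).comp
      tendsto_natCast_atTop_atTop)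
    exact this.eventually_le_const (by positivity)
  filter_upwards [ev1, ev2, eventually_ge_atTop (k + 1)] with N e1 e2 e3 L hL j hj1 hj2
  set H : ℕ := ⌊(N : ℝ) ^ η⌋₊ with hH
  have hN1 : (1 : ℝ) ≤ N := by exact_mod_cast (by omega : 1 ≤ N)
  have hN0 : (0 : ℝ) < N := by linarith
  have hkN : (k : ℝ) + 1 ≤ N := by exact_mod_cast e3
  have hHle : (H : ℝ) ≤ (N : ℝ) ^ η := Nat.floor_le (by positivity)
  have hH1 : (1 : ℝ) ≤ H := by
    exact_mod_cast Nat.le_floor (by simpa using Real.one_le_rpow hN1 hη0.le)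
  have hjR : (1 : ℝ) ≤ j := by exact_mod_cast hj1
  have hjH : (j : ℝ) ≤ H := by exact_mod_cast hj2
  -- the mean value theorem for the differences of the phase
  have hdiff : ∀ r n : ℕ, ∃ ξ : ℝ, (N : ℝ) + n ≤ ξ ∧ ξ ≤ N + n + r ∧
      (fwdDiff 1)^[r] (fun n : ℕ => (j : ℝ) * ((N + n : ℕ) : ℝ) ^ α) n =
        j * ((∏ i ∈ range r, (α - i)) * ξ ^ (α - r)) := by
    intro r n
    have hpos : (0 : ℝ) < ((N + n : ℕ) : ℝ) := by push_cast; positivity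
    obtain ⟨ξ, a1, a2, a3⟩ := exists_fwdDiff_iter_rpow α r hpos
    refine ⟨ξ, by exact_mod_cast a1, by exact_mod_cast a2, ?_⟩
    rw [fwdDiff_iter_mul, fwdDiff_iter_comp_add_natCast (fun t : ℝ => t ^ α), a3]
  have hexp : α - ((k + 1 : ℕ) : ℝ) = -ρ := by rw [hρ]; push_cast; ring
  refine norm_sum_expTwoPi_le k _ L H N (P * (3 * N) ^ (-ρ)) (j * (P * (N : ℝ) ^ (-ρ))) H
    (by positivity) ?_ ?_ ?_ ?_ hH1 le_rfl ?_ hL ?_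
  · intro n hn
    obtain ⟨ξ, a1, a2, a3⟩ := hdiff (k + 1) n
    rw [a3, hexp]
    have hn' : (n : ℝ) ≤ N := by exact_mod_cast (hn.le.trans hL)
    push_cast at a2
    have hn0 : (0 : ℝ) ≤ n := Nat.cast_nonneg _
    have hξ : (3 * N : ℝ) ^ (-ρ) ≤ ξ ^ (-ρ) :=
      Real.rpow_le_rpow_of_nonpos (by linarith) (by linarith) (by linarith)
    calc P * (3 * N : ℝ) ^ (-ρ) ≤ P * ξ ^ (-ρ) := by gcongr
      _ ≤ j * (P * ξ ^ (-ρ)) := le_mul_of_one_le_left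
        (mul_nonneg hP0.le (Real.rpow_nonneg (by linarith) _)) hjR
  · intro n
    obtain ⟨ξ, a1, a2, a3⟩ := hdiff (k + 1 + 1) n
    have hs : (fwdDiff 1)^[k + 1] (fun n : ℕ => (j : ℝ) * ((N + n : ℕ) : ℝ) ^ α) (n + 1) -
        (fwdDiff 1)^[k + 1] (fun n : ℕ => (j : ℝ) * ((N + n : ℕ) : ℝ) ^ α) n =
        (fwdDiff 1)^[k + 1 + 1] (fun n : ℕ => (j : ℝ) * ((N + n : ℕ) : ℝ) ^ α) n := by
      rw [Function.iterate_succ_apply' _ (k + 1), fwdDiff]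
    rw [← sub_nonpos, hs, a3, prod_range_succ, ← hP]
    have hn0 : (0 : ℝ) ≤ n := Nat.cast_nonneg _
    have hneg : α - ((k + 1 : ℕ) : ℝ) ≤ 0 := by rw [hexp]; linarith
    have hp : 0 ≤ ξ ^ (α - ((k + 1 + 1 : ℕ) : ℝ)) := Real.rpow_nonneg (by linarith) _
    have : 0 ≤ j * (P * ξ ^ (α - ((k + 1 + 1 : ℕ) : ℝ))) := by positivity
    nlinarith
  · intro n
    obtain ⟨ξ, a1, a2, a3⟩ := hdiff (k + 1) n
    rw [a3, hexp]
    have hn0 : (0 : ℝ) ≤ n := Nat.cast_nonneg _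
    have hξ : ξ ^ (-ρ) ≤ (N : ℝ) ^ (-ρ) :=
      Real.rpow_le_rpow_of_nonpos hN0 (by linarith) (by linarith)
    gcongr
  · calc j * (P * (N : ℝ) ^ (-ρ)) * (H : ℝ) ^ k ≤ (N : ℝ) ^ η * (P * (N : ℝ) ^ (-ρ)) *
          ((N : ℝ) ^ η) ^ k := by
          have := hjH.trans hHle
          gcongr
      _ = P * (N : ℝ) ^ (-(ρ - η * (k + 1))) := by
        have : ((N : ℝ) ^ η) ^ k = (N : ℝ) ^ (η * k) := by
          rw [Real.rpow_mul hN0.le, Real.rpow_natCast]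
        rw [this, show -(ρ - η * (k + 1)) = η + (-ρ) + η * k by ring, Real.rpow_add hN0,
          Real.rpow_add hN0]
        ring
      _ ≤ _ := e1
  · calc (H : ℝ) ≤ (N : ℝ) ^ η := hHle
      _ = (N : ℝ) ^ (-(1 - ρ - η)) * (N : ℝ) ^ (1 - ρ) := by
        rw [← Real.rpow_add hN0]; congr 1; ring
      _ ≤ P * 3 ^ (-ρ) * (N : ℝ) ^ (1 - ρ) := by gcongr
      _ = P * (3 * N) ^ (-ρ) * N := by
        rw [Real.mul_rpow (by norm_num) hN0.le, show (1 : ℝ) - ρ = -ρ + 1 by ring,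
          Real.rpow_add hN0, Real.rpow_one]
        ring
  · have : (H : ℝ) ≤ N := hHle.trans (Real.rpow_le_self_of_one_le hN1 (by linarith))
    exact_mod_cast this

/-- The difference `⌈n ^ α⌉ - n ^ α - 1 / 2`, see `natCeil_rpow_eq`. -/
noncomputable def ceilDefect (α : ℝ) (n : ℕ) : ℝ := Int.fract (-(n : ℝ) ^ α) - 1 / 2

lemma abs_ceilDefect_le (α : ℝ) (n : ℕ) : |ceilDefect α n| ≤ 1 / 2 := by
  rw [ceilDefect, abs_le]
  constructor <;> linarith [Int.fract_nonneg (-(n : ℝ) ^ α), Int.fract_lt_one (-(n : ℝ) ^ α)]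

lemma natCeil_rpow_eq (α : ℝ) (n : ℕ) :
    (⌈(n : ℝ) ^ α⌉₊ : ℝ) = (n : ℝ) ^ α + 1 / 2 + ceilDefect α n := by
  have h0 : (0 : ℝ) ≤ (n : ℝ) ^ α := by positivity
  rw [natCast_ceil_eq_intCast_ceil h0, ceilDefect, Int.fract, Int.floor_neg]
  push_cast
  ring

lemma exists_block_sum_ceilDefect_le {α : ℝ} (hα : 0 < α) (hn : ∀ a : ℕ, α ≠ a) :
    ∃ σ : ℝ, 0 < σ ∧ σ < 1 ∧ ∃ C : ℝ, 0 ≤ C ∧ ∀ N : ℕ, 1 ≤ N → ∀ L ≤ N,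
      |∑ n ∈ range L, ceilDefect α (N + n)| ≤ C * (N : ℝ) ^ (1 - σ) := by
  set k := ⌊α⌋₊ with hk
  have hk1 : (k : ℝ) < α := lt_of_le_of_ne (Nat.floor_le hα.le) (hn k).symm
  have hk2 : α < k + 1 := Nat.lt_floor_add_one α
  obtain ⟨η, hη0, hη1, hev⟩ := eventually_norm_sum_expTwoPi_rpow_le hk1 hk2
  obtain ⟨N₀, hN₀⟩ := eventually_atTop.1 hev
  set τ : ℝ := (1 / 2 : ℝ) ^ k with hτ
  have hτ0 : 0 < τ := by positivity
  have hτ1 : τ ≤ 1 := pow_le_one₀ (by norm_num) (by norm_num)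
  refine ⟨η * τ / 2, by positivity, by nlinarith, 16 + N₀, by positivity, ?_⟩
  intro N hN L hL
  have hN1 : (1 : ℝ) ≤ N := by exact_mod_cast hN
  have hN0 : (0 : ℝ) < N := by linarith
  have hpow1 : 1 ≤ (N : ℝ) ^ (1 - η * τ / 2) := Real.one_le_rpow hN1 (by nlinarith)
  rcases lt_or_ge N N₀ with h | h
  · have h3 : |∑ n ∈ range L, ceilDefect α (N + n)| ≤ L := by
      refine (abs_sum_le_sum_abs _ _).trans ?_
      refine (sum_le_card_nsmul _ _ 1 fun n _ => ?_).trans (by simp)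
      linarith [abs_ceilDefect_le α (N + n)]
    have h4 : (L : ℝ) ≤ N₀ := by exact_mod_cast (hL.trans h.le)
    have h5 : (0 : ℝ) ≤ N₀ := Nat.cast_nonneg _
    nlinarith
  · set H : ℕ := ⌊(N : ℝ) ^ η⌋₊ with hH
    have hNη : (1 : ℝ) ≤ (N : ℝ) ^ η := Real.one_le_rpow hN1 hη0.le
    have hH1 : 1 ≤ H := Nat.le_floor (by simpa using hNη)
    have hHR : (1 : ℝ) ≤ H := by exact_mod_cast hH1
    have hH0 : (0 : ℝ) < H := by linarith
    set D : ℝ := (H : ℝ) ^ (-τ) with hD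
    set δ : ℝ := (H : ℝ) ^ (-(τ / 2)) with hδ
    have hDδ : D = δ * δ := by rw [hD, hδ, ← Real.rpow_add hH0]; congr 1; ring
    have hδ0 : 0 < δ := by positivity
    have hδ1 : δ ≤ 1 := Real.rpow_le_one_of_one_le_of_nonpos hHR (by linarith)
    have hHD : 1 / (H : ℝ) ≤ D := by
      rw [one_div, ← Real.rpow_neg_one]
      exact Real.rpow_le_rpow_of_exponent_le hHR (by linarith)
    have hb := abs_sum_periodicBernoulliTwo_le (x := fun n => ((N + n : ℕ) : ℝ) ^ α) hL hH1
      (B := 6 * N * D) (by positivity) (fun j h1 h2 => hN₀ N h L hL j h1 h2)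
    have hc := abs_sum_fract_neg_le (x := fun n => ((N + n : ℕ) : ℝ) ^ α) hL hδ0 hδ1 (D := 7 * D)
      (fun y => (hb y).trans (by
        have : (N : ℝ) / H = N * (1 / H) := by ring
        rw [this]; nlinarith))
    have hδN : δ ≤ 2 * (N : ℝ) ^ (-(η * τ / 2)) := by
      have h1 : (N : ℝ) ^ η / 2 ≤ H := by
        have := Nat.lt_floor_add_one ((N : ℝ) ^ η)
        rw [← hH] at this; linarith
      calc δ ≤ ((N : ℝ) ^ η / 2) ^ (-(τ / 2)) :=
            Real.rpow_le_rpow_of_nonpos (by positivity) h1 (by linarith)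
        _ = (2 : ℝ) ^ (τ / 2) * (N : ℝ) ^ (-(η * τ / 2)) := by
          rw [Real.div_rpow (by positivity) (by norm_num), ← Real.rpow_mul hN0.le,
            Real.rpow_neg (by norm_num : (0 : ℝ) ≤ 2), div_inv_eq_mul, mul_comm]
          congr 2; ring
        _ ≤ 2 * (N : ℝ) ^ (-(η * τ / 2)) := by
          gcongr
          exact Real.rpow_le_self_of_one_le (by norm_num) (by linarith)
    have hfin : (N : ℝ) * (7 * D / δ + δ / 2) ≤ N * (8 * δ) := by
      rw [hDδ]
      have : 7 * (δ * δ) / δ = 7 * δ := by field_simp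
      rw [this]; gcongr; linarith
    refine (hc.trans hfin).trans ?_
    calc (N : ℝ) * (8 * δ) ≤ N * (8 * (2 * (N : ℝ) ^ (-(η * τ / 2)))) := by gcongr
      _ = 16 * (N : ℝ) ^ (1 - η * τ / 2) := by
        rw [sub_eq_add_neg, Real.rpow_add hN0, Real.rpow_one]; ring
      _ ≤ _ := by gcongr; simp

/-- The partial sums of `⌈n ^ α⌉ - n ^ α - 1 / 2` have a power saving when `α` is not an integer. -/
lemma exists_sum_ceilDefect_le {α : ℝ} (hα : 0 < α) (hn : ∀ a : ℕ, α ≠ a) :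
    ∃ σ : ℝ, 0 < σ ∧ σ < 1 ∧ ∃ C : ℝ, 0 ≤ C ∧ ∀ x : ℕ,
      |∑ n ∈ range x, ceilDefect α (n + 1)| ≤ C * (x : ℝ) ^ (1 - σ) := by
  obtain ⟨σ, hσ0, hσ1, C, hC0, hC⟩ := exists_block_sum_ceilDefect_le hα hn
  set q : ℝ := (1 / 2 : ℝ) ^ (1 - σ) with hq
  have hq1 : q < 1 := Real.rpow_lt_one (by norm_num) (by norm_num) (by linarith)
  have hq0 : 0 < q := by positivity
  have hq' : 0 < 1 - q := by linarith
  refine ⟨σ, hσ0, hσ1, C / (1 - q), by positivity, ?_⟩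
  intro x
  induction x using Nat.strong_induction_on with
  | _ x ih =>
    rcases Nat.eq_zero_or_pos x with rfl | hx
    · simp; positivity
    set y := x / 2 with hy
    have hsplit : ∑ n ∈ range x, ceilDefect α (n + 1) =
        ∑ n ∈ range y, ceilDefect α (n + 1) +
          ∑ n ∈ range (x - y), ceilDefect α (y + 1 + n) := by
      conv_lhs => rw [show x = y + (x - y) by omega]
      rw [sum_range_add]
      congr 1
      exact sum_congr rfl fun n _ => by congr 1; ring
    have h1 := ih y (by omega)
    have h2 := hC (y + 1) (by omega) (x - y) (by omega)
    have hy2 : (y : ℝ) ≤ x * (1 / 2) := by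
      have : (y : ℝ) * 2 ≤ x := by exact_mod_cast Nat.div_mul_le_self x 2
      linarith
    have h3 : (y : ℝ) ^ (1 - σ) ≤ (x : ℝ) ^ (1 - σ) * q := by
      rw [hq, ← Real.mul_rpow (by positivity) (by norm_num)]
      exact Real.rpow_le_rpow (by positivity) hy2 (by linarith)
    have h4 : ((y + 1 : ℕ) : ℝ) ^ (1 - σ) ≤ (x : ℝ) ^ (1 - σ) :=
      Real.rpow_le_rpow (by positivity) (by exact_mod_cast (by omega : y + 1 ≤ x)) (by linarith)
    rw [hsplit]
    calc _ ≤ C / (1 - q) * ((x : ℝ) ^ (1 - σ) * q) + C * (x : ℝ) ^ (1 - σ) := by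
          refine (abs_add_le _ _).trans (add_le_add (h1.trans ?_) (h2.trans ?_))
          · gcongr
          · gcongr
      _ = _ := by field_simp; ring

/-! ### Taylor remainders of `x ^ (-s)` and the series built from them -/

/-- The rising factorial `s (s + 1) ⋯ (s + h - 1)`. -/
noncomputable def risingFactorial (s : ℂ) (h : ℕ) : ℂ := ∏ i ∈ range h, (s + i)

lemma risingFactorial_succ_left (s : ℂ) (h : ℕ) :
    risingFactorial s (h + 1) = s * risingFactorial (s + 1) h := by
  rw [risingFactorial, prod_range_succ', risingFactorial, mul_comm]
  congr 1
  · simp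
  · refine prod_congr rfl fun i _ => ?_
    push_cast; ring

lemma differentiable_risingFactorial (h : ℕ) : Differentiable ℂ fun s => risingFactorial s h := by
  unfold risingFactorial
  fun_prop

lemma risingFactorial_zero_left {h : ℕ} (hh : 1 ≤ h) : risingFactorial 0 h = 0 := by
  obtain ⟨h, rfl⟩ := Nat.exists_eq_add_of_le' hh
  rw [risingFactorial_succ_left, zero_mul]

lemma risingFactorial_one_left (h : ℕ) : risingFactorial 1 h = h.factorial := by
  induction h with
  | zero => simp [risingFactorial]
  | succ h ih =>
    rw [risingFactorial, prod_range_succ, ← risingFactorial, ih, Nat.factorial_succ]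
    push_cast; ring

lemma norm_risingFactorial_le (s : ℂ) (h : ℕ) : ‖risingFactorial s h‖ ≤ (‖s‖ + h) ^ h := by
  rw [risingFactorial, norm_prod]
  calc ∏ i ∈ range h, ‖s + i‖ ≤ ∏ i ∈ range h, (‖s‖ + h) := by
        refine prod_le_prod (fun _ _ => norm_nonneg _) fun i hi => ?_
        refine (norm_add_le _ _).trans ?_
        rw [Complex.norm_natCast]
        have : (i : ℝ) ≤ h := by exact_mod_cast (mem_range.1 hi).le
        linarith
    _ = _ := by simp

lemma norm_risingFactorial_le_of_one_le {s : ℂ} (hs : 1 ≤ ‖s‖) (h : ℕ) :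
    ‖risingFactorial s h‖ ≤ (1 + h : ℝ) ^ h * ‖s‖ ^ h := by
  refine (norm_risingFactorial_le s h).trans ?_
  rw [← mul_pow]
  have : (0 : ℝ) ≤ h := Nat.cast_nonneg _
  refine pow_le_pow_left₀ (by positivity) ?_ _
  nlinarith

/-- The remainder of order `k` in the expansion of `(x - t) ^ (-s)` in powers of `t`. -/
noncomputable def taylorRem (k : ℕ) (s : ℂ) (x t : ℝ) : ℂ :=
  ((x - t : ℝ) : ℂ) ^ (-s) -
    ∑ h ∈ range k, risingFactorial s h / h.factorial * (t : ℂ) ^ h * (x : ℂ) ^ (-s - h)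

lemma taylorRem_zero_right {k : ℕ} (hk : 1 ≤ k) (s : ℂ) (x : ℝ) : taylorRem k s x 0 = 0 := by
  obtain ⟨k, rfl⟩ := Nat.exists_eq_add_of_le' hk
  rw [taylorRem, sum_range_succ']
  simp [risingFactorial]

lemma hasDerivAt_taylorRem (k : ℕ) (s : ℂ) {x t : ℝ} (hxt : t < x) :
    HasDerivAt (fun t => taylorRem (k + 1) s x t) (s * taylorRem k (s + 1) x t) t := by
  have h1 : HasDerivAt (fun t : ℝ => ((x - t : ℝ) : ℂ) ^ (-s))
      (s * ((x - t : ℝ) : ℂ) ^ (-(s + 1))) t := by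
    have ha : HasDerivAt (fun t : ℝ => ((x - t : ℝ) : ℂ)) ((-1 : ℝ) : ℂ) t :=
      ((hasDerivAt_id t).const_sub x).ofReal_comp
    have hslit : ((x - t : ℝ) : ℂ) ∈ slitPlane :=
      Complex.ofReal_mem_slitPlane.2 (by linarith)
    have := ((hasDerivAt_id (((x - t : ℝ) : ℂ))).cpow_const (c := -s) hslit).comp t ha
    refine HasDerivAt.congr_deriv this ?_
    rw [show -(s + 1) = -s - 1 by ring, id]
    push_cast; ring
  have h2 : HasDerivAt (fun t : ℝ => ∑ h ∈ range (k + 1),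
      risingFactorial s h / h.factorial * (t : ℂ) ^ h * (x : ℂ) ^ (-s - h))
      (s * ∑ h ∈ range k,
        risingFactorial (s + 1) h / h.factorial * (t : ℂ) ^ h * (x : ℂ) ^ (-(s + 1) - h)) t := by
    have hfun : (fun t : ℝ => ∑ h ∈ range (k + 1),
        risingFactorial s h / h.factorial * (t : ℂ) ^ h * (x : ℂ) ^ (-s - h)) = fun t : ℝ =>
        ∑ h ∈ range k, risingFactorial s (h + 1) / (h + 1).factorial * (t : ℂ) ^ (h + 1) *
          (x : ℂ) ^ (-s - ((h + 1 : ℕ) : ℂ)) +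
          risingFactorial s 0 / Nat.factorial 0 * 1 * (x : ℂ) ^ (-s - ((0 : ℕ) : ℂ)) := by
      funext t; rw [sum_range_succ', pow_zero]
    rw [hfun, mul_sum]
    refine HasDerivAt.add_const _ (HasDerivAt.fun_sum fun h _ => ?_)
    have hp : HasDerivAt (fun t : ℝ => (t : ℂ) ^ (h + 1)) ((h + 1 : ℕ) * (t : ℂ) ^ h) t := by
      have := (hasDerivAt_pow (h + 1) (t : ℂ)).comp_ofReal
      simpa using this
    have := (hp.const_mul (risingFactorial s (h + 1) / (h + 1).factorial : ℂ)).mul_const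
      ((x : ℂ) ^ (-s - ((h + 1 : ℕ) : ℂ)))
    refine HasDerivAt.congr_deriv this ?_
    rw [risingFactorial_succ_left, Nat.factorial_succ,
      show -(s + 1) - (h : ℂ) = -s - ((h + 1 : ℕ) : ℂ) by push_cast; ring]
    have e1 : ((h.factorial : ℕ) : ℂ) ≠ 0 := by exact_mod_cast h.factorial_ne_zero
    have e2 : ((h : ℂ) + 1) ≠ 0 := by exact_mod_cast h.succ_ne_zero
    push_cast
    field_simp
  have := h1.sub h2
  rw [← mul_sub] at this
  exact this

lemma norm_taylorRem_le (k : ℕ) : ∀ (s : ℂ) {x t : ℝ}, 1 < x → |t| ≤ 1 → 0 ≤ s.re + k →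
    ‖taylorRem k s x t‖ ≤ ‖risingFactorial s k‖ * (x - 1) ^ (-(s.re + k)) := by
  induction k with
  | zero =>
    intro s x t hx ht hs
    have ht' := abs_le.1 ht
    simp only [Nat.cast_zero, add_zero] at hs
    simp only [taylorRem, range_zero, sum_empty, sub_zero, risingFactorial, prod_empty, norm_one,
      one_mul, Nat.cast_zero, add_zero]
    rw [Complex.norm_cpow_eq_rpow_re_of_pos (by linarith)]
    exact Real.rpow_le_rpow_of_nonpos (by linarith) (by linarith [ht'.2])
      (by rw [Complex.neg_re]; linarith)
  | succ k ih =>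
    intro s x t hx ht hs
    have ht' := abs_le.1 ht
    push_cast at hs
    set C : ℝ := ‖risingFactorial s (k + 1)‖ * (x - 1) ^ (-(s.re + (k + 1 : ℕ))) with hC
    have hC0 : 0 ≤ C := mul_nonneg (norm_nonneg _) (Real.rpow_nonneg (by linarith) _)
    have hb : ∀ y ∈ Set.Icc (-1 : ℝ) 1, ‖s * taylorRem k (s + 1) x y‖ ≤ C := by
      intro y hy
      rw [norm_mul]
      have := ih (s + 1) hx (abs_le.2 hy) (by simp; linarith)
      refine (mul_le_mul_of_nonneg_left this (norm_nonneg _)).trans (le_of_eq ?_)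
      rw [hC, risingFactorial_succ_left, norm_mul, mul_assoc]
      congr 4
      simp; ring
    have := (convex_Icc (-1 : ℝ) 1).norm_image_sub_le_of_norm_hasDerivWithin_le
      (f := fun t => taylorRem (k + 1) s x t) (C := C)
      (fun y hy => (hasDerivAt_taylorRem k s (by linarith [hy.2] : y < x)).hasDerivWithinAt) hb
      (x := 0) (y := t) (by simp) ht'
    simp only [taylorRem_zero_right (Nat.le_add_left 1 k), sub_zero] at this
    refine this.trans ?_
    rw [Real.norm_eq_abs]
    nlinarith

lemma differentiable_taylorRem (k : ℕ) {x t : ℝ} (hx : 0 < x) (hxt : t < x) :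
    Differentiable ℂ fun s => taylorRem k s x t := by
  have h1 : ∀ {y : ℝ}, 0 < y → ∀ c : ℂ, Differentiable ℂ fun s : ℂ => (y : ℂ) ^ (-s - c) := by
    intro y hy c
    have hy0 : (y : ℂ) ≠ 0 := by exact_mod_cast hy.ne'
    intro s
    exact ((differentiableAt_id.neg).sub_const c).const_cpow (Or.inl hy0)
  unfold taylorRem
  refine Differentiable.sub (by simpa using h1 (by linarith : 0 < x - t) 0) ?_
  refine Differentiable.fun_sum fun h _ => ?_
  exact (((differentiable_risingFactorial h).div_const _).mul_const _).mul (h1 hx h)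

/-- A sequence of entire functions whose size is that of the `k`-th derivative of
`n ^ (-s)` with respect to `n`. -/
structure IsDerivLike (k : ℕ) (F : ℕ → ℂ → ℂ) : Prop where
  differentiable : ∀ n, Differentiable ℂ (F n)
  norm_le : ∀ (n : ℕ) (s : ℂ), 0 ≤ s.re + k →
    ‖F n s‖ ≤ 2 * ‖risingFactorial s k‖ * ((n : ℝ) + 1) ^ (-(s.re + k))

namespace IsDerivLike

variable {k : ℕ} {F : ℕ → ℂ → ℂ} {β C : ℝ} {u : ℕ → ℝ}

lemma norm_mul_le (hF : IsDerivLike k F) (hβ : 0 ≤ β) (hu : ∀ n, |u n| ≤ C * ((n : ℝ) + 1) ^ β)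
    (hC : 0 ≤ C) {ε : ℝ} (hε : 0 < ε) {s : ℂ} (hs : β + 1 - k + ε ≤ s.re) (n : ℕ) :
    ‖(u n : ℂ) * F n s‖ ≤ 2 * C * ‖risingFactorial s k‖ * ((n : ℝ) + 1) ^ (-(1 + ε)) := by
  have hn : (1 : ℝ) ≤ (n : ℝ) + 1 := by linarith [(Nat.cast_nonneg n : (0 : ℝ) ≤ n)]
  have hn0 : (0 : ℝ) < (n : ℝ) + 1 := by linarith
  rw [norm_mul, Complex.norm_real, Real.norm_eq_abs]
  calc |u n| * ‖F n s‖ ≤ (C * ((n : ℝ) + 1) ^ β) *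
        (2 * ‖risingFactorial s k‖ * ((n : ℝ) + 1) ^ (-(s.re + k))) :=
        mul_le_mul (hu n) (hF.norm_le n s (by linarith)) (norm_nonneg _) (by positivity)
    _ = 2 * C * ‖risingFactorial s k‖ * (((n : ℝ) + 1) ^ (β + -(s.re + k))) := by
        rw [Real.rpow_add hn0]; ring
    _ ≤ _ := by
        gcongr
        linarith

lemma summable_rpow {ε : ℝ} (hε : 0 < ε) : Summable fun n : ℕ => ((n : ℝ) + 1) ^ (-(1 + ε)) := by
  have := (summable_nat_add_iff 1).2 (Real.summable_nat_rpow (p := -(1 + ε)) |>.2 (by linarith))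
  simpa using this

lemma summable (hF : IsDerivLike k F) (hβ : 0 ≤ β) (hu : ∀ n, |u n| ≤ C * ((n : ℝ) + 1) ^ β)
    (hC : 0 ≤ C) {s : ℂ} (hs : β + 1 - k < s.re) : Summable fun n => (u n : ℂ) * F n s :=
  Summable.of_norm_bounded ((summable_rpow (ε := s.re - (β + 1 - k)) (by linarith)).mul_left _)
    (hF.norm_mul_le hβ hu hC (by linarith) (by linarith))

lemma exists_norm_tsum_le (hF : IsDerivLike k F) (hβ : 0 ≤ β)
    (hu : ∀ n, |u n| ≤ C * ((n : ℝ) + 1) ^ β) (hC : 0 ≤ C) {ε : ℝ} (hε : 0 < ε) :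
    ∃ D, 0 ≤ D ∧ ∀ s : ℂ, β + 1 - k + ε ≤ s.re →
      ‖∑' n, (u n : ℂ) * F n s‖ ≤ D * ‖risingFactorial s k‖ := by
  refine ⟨2 * C * ∑' n : ℕ, ((n : ℝ) + 1) ^ (-(1 + ε)),
    mul_nonneg (by positivity) (tsum_nonneg fun n => by positivity), fun s hs => ?_⟩
  have h := tsum_of_norm_bounded ((summable_rpow hε).hasSum.mul_left
    (2 * C * ‖risingFactorial s k‖)) (hF.norm_mul_le hβ hu hC hε hs)
  exact h.trans (le_of_eq (by ring))

/-- Around each point of the half-plane `β + 1 - k < Re s` the series of `u n * F n s` is dominated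
by a convergent series that does not depend on `s`. -/
lemma exists_dominating (hF : IsDerivLike k F) (hβ : 0 ≤ β)
    (hu : ∀ n, |u n| ≤ C * ((n : ℝ) + 1) ^ β) (hC : 0 ≤ C) {s : ℂ} (hs : β + 1 - k < s.re) :
    ∃ U : Set ℂ, IsOpen U ∧ s ∈ U ∧ ∃ b : ℕ → ℝ, Summable b ∧
      ∀ n, ∀ z ∈ U, ‖(u n : ℂ) * F n z‖ ≤ b n := by
  set ε := (s.re - (β + 1 - k)) / 2 with hε
  have hε0 : 0 < ε := by rw [hε]; linarith
  refine ⟨{z : ℂ | β + 1 - k + ε < z.re} ∩ {z : ℂ | ‖z‖ < ‖s‖ + 1}, ?_, ?_,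
    fun n => 2 * C * (‖s‖ + 1 + k) ^ k * ((n : ℝ) + 1) ^ (-(1 + ε)), ?_, ?_⟩
  · exact (isOpen_lt continuous_const Complex.continuous_re).inter
      (isOpen_lt continuous_norm continuous_const)
  · refine ⟨?_, ?_⟩
    · show β + 1 - k + ε < s.re
      rw [hε]; linarith
    · show ‖s‖ < ‖s‖ + 1
      linarith
  · exact (summable_rpow hε0).mul_left _
  · rintro n z ⟨h1, h2⟩
    refine (hF.norm_mul_le hβ hu hC hε0 (le_of_lt h1) n).trans ?_
    have h3 : ‖risingFactorial z k‖ ≤ (‖s‖ + 1 + k) ^ k :=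
      (norm_risingFactorial_le z k).trans (by gcongr; exact le_of_lt h2)
    beta_reduce
    gcongr

lemma differentiableAt_tsum (hF : IsDerivLike k F) (hβ : 0 ≤ β)
    (hu : ∀ n, |u n| ≤ C * ((n : ℝ) + 1) ^ β) (hC : 0 ≤ C) {s : ℂ} (hs : β + 1 - k < s.re) :
    DifferentiableAt ℂ (fun z => ∑' n, (u n : ℂ) * F n z) s := by
  obtain ⟨U, hU, hsU, b, hb, hle⟩ := hF.exists_dominating hβ hu hC hs
  exact (differentiableOn_tsum_of_summable_norm hb
    (fun n => ((hF.differentiable n).const_mul _).differentiableOn) hU hle).differentiableAt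
      (hU.mem_nhds hsU)

lemma analyticAt_tsum (hF : IsDerivLike k F) (hβ : 0 ≤ β)
    (hu : ∀ n, |u n| ≤ C * ((n : ℝ) + 1) ^ β) (hC : 0 ≤ C) {s : ℂ} (hs : β + 1 - k < s.re) :
    AnalyticAt ℂ (fun z => ∑' n, (u n : ℂ) * F n z) s := by
  rw [analyticAt_iff_eventually_differentiableAt]
  filter_upwards [(isOpen_lt continuous_const Complex.continuous_re).mem_nhds hs] with z hz
  exact hF.differentiableAt_tsum hβ hu hC hz

lemma hasSum_deriv (hF : IsDerivLike k F) (hβ : 0 ≤ β)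
    (hu : ∀ n, |u n| ≤ C * ((n : ℝ) + 1) ^ β) (hC : 0 ≤ C) {s : ℂ} (hs : β + 1 - k < s.re) :
    HasSum (fun n => (u n : ℂ) * deriv (F n) s) (deriv (fun z => ∑' n, (u n : ℂ) * F n z) s) := by
  obtain ⟨U, hU, hsU, b, hb, hle⟩ := hF.exists_dominating hβ hu hC hs
  have := hasSum_deriv_of_summable_norm hb
    (fun n => ((hF.differentiable n).const_mul (u n : ℂ)).differentiableOn) hU hle hsU
  have e : ∀ n, deriv (fun z => (u n : ℂ) * F n z) s = u n * deriv (F n) s :=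
    fun n => deriv_const_mul _ ((hF.differentiable n) s)
  simpa only [e] using this

end IsDerivLike

lemma isDerivLike_taylorRem (k : ℕ) :
    IsDerivLike k fun n s => taylorRem k s ((n : ℝ) + 2) 1 where
  differentiable := fun n => by
    have hn : (0 : ℝ) ≤ n := Nat.cast_nonneg _
    exact differentiable_taylorRem k (by linarith) (by linarith)
  norm_le := fun n s hs => by
    have hn : (0 : ℝ) ≤ n := Nat.cast_nonneg _
    have := norm_taylorRem_le k s (x := (n : ℝ) + 2) (t := 1) (by linarith) (by simp) hs
    rw [show (n : ℝ) + 2 - 1 = n + 1 by ring] at this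
    refine this.trans ?_
    have h0 : 0 ≤ ‖risingFactorial s k‖ * ((n : ℝ) + 1) ^ (-(s.re + k)) := by positivity
    linarith

/-- The second difference `(n + 1) ^ (-s) - 2 (n + 2) ^ (-s) + (n + 3) ^ (-s)`. -/
noncomputable def secondDiff (n : ℕ) (s : ℂ) : ℂ :=
  ((n : ℂ) + 1) ^ (-s) - 2 * ((n : ℂ) + 2) ^ (-s) + ((n : ℂ) + 3) ^ (-s)

/-- The two Taylor expansions at `n + 2`, in the directions of `n + 1` and `n + 3`, have opposite
linear terms. -/
lemma secondDiff_eq (n : ℕ) (s : ℂ) :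
    secondDiff n s = taylorRem 2 s ((n : ℝ) + 2) 1 + taylorRem 2 s ((n : ℝ) + 2) (-1) := by
  rw [secondDiff, taylorRem, taylorRem, sum_range_succ, sum_range_one, sum_range_succ,
    sum_range_one, show (n : ℝ) + 2 - 1 = n + 1 by ring, show (n : ℝ) + 2 - -1 = n + 3 by ring]
  simp [risingFactorial]
  ring

lemma isDerivLike_secondDiff : IsDerivLike 2 secondDiff where
  differentiable := fun n => by
    have hn : (0 : ℝ) ≤ n := Nat.cast_nonneg _
    have : secondDiff n = fun s => taylorRem 2 s ((n : ℝ) + 2) 1 +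
        taylorRem 2 s ((n : ℝ) + 2) (-1) := funext (secondDiff_eq n)
    rw [this]
    exact (differentiable_taylorRem 2 (by linarith) (by linarith)).add
      (differentiable_taylorRem 2 (by linarith) (by linarith))
  norm_le := fun n s hs => by
    have hn : (0 : ℝ) ≤ n := Nat.cast_nonneg _
    have h1 := norm_taylorRem_le 2 s (x := (n : ℝ) + 2) (t := 1) (by linarith) (by simp) hs
    have h2 := norm_taylorRem_le 2 s (x := (n : ℝ) + 2) (t := -1) (by linarith) (by simp) hs
    rw [show (n : ℝ) + 2 - 1 = n + 1 by ring] at h1 h2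
    rw [secondDiff_eq]
    refine (norm_add_le _ _).trans ?_
    linarith

/-! ### The weighted telescoping series and polynomial growth of the Riemann zeta function -/

/-- The meromorphic continuation to `α - k < Re s` of the series
`∑ n, (n + 2) ^ α * ((n + 1) ^ (-s) - (n + 2) ^ (-s))`, obtained by expanding `(n + 1) ^ (-s)` to
order `k` in powers of `1 / (n + 2)`. -/
noncomputable def telescopeSum (α : ℝ) (k : ℕ) (s : ℂ) : ℂ :=
  ∑ h ∈ Icc 1 k, risingFactorial s h / h.factorial * (riemannZeta (s - α + h) - 1) +
    ∑' n : ℕ, ((((n : ℝ) + 2) ^ α : ℝ) : ℂ) * taylorRem (k + 1) s ((n : ℝ) + 2) 1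

lemma abs_add_two_rpow_le {α : ℝ} (hα : 0 ≤ α) (n : ℕ) :
    |((n : ℝ) + 2) ^ α| ≤ 2 ^ α * ((n : ℝ) + 1) ^ α := by
  have hn : (0 : ℝ) ≤ n := Nat.cast_nonneg _
  rw [abs_of_nonneg (by positivity), ← Real.mul_rpow (by norm_num) (by positivity)]
  exact Real.rpow_le_rpow (by positivity) (by linarith) hα

lemma hasSum_add_two_cpow {w : ℂ} (hw : 1 < w.re) :
    HasSum (fun n : ℕ => ((n : ℂ) + 2) ^ (-w)) (riemannZeta w - 1) := by
  have hs : Summable fun n : ℕ => 1 / ((n : ℂ) + 1) ^ w := by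
    have := (summable_nat_add_iff 1).2 (Complex.summable_one_div_nat_cpow.2 hw)
    simpa using this
  have h := hs.hasSum
  rw [← zeta_eq_tsum_one_div_nat_add_one_cpow hw] at h
  have h2 := (hasSum_nat_add_iff' 1).2 h
  simp only [sum_range_one, Nat.cast_zero, zero_add, Complex.one_cpow, div_one] at h2
  convert! h2 using 2 with n
  rw [Complex.cpow_neg, one_div]
  push_cast
  rw [add_assoc]
  norm_num

lemma ofReal_rpow_mul_cpow {x : ℝ} (hx : 0 < x) (α : ℝ) (w : ℂ) :
    ((x ^ α : ℝ) : ℂ) * (x : ℂ) ^ w = (x : ℂ) ^ (α + w) := by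
  rw [Complex.ofReal_cpow hx.le, ← Complex.cpow_add _ _ (by exact_mod_cast hx.ne')]

lemma add_two_rpow_mul_taylorRem (α : ℝ) (k : ℕ) (s : ℂ) (n : ℕ) :
    ((((n : ℝ) + 2) ^ α : ℝ) : ℂ) * (((n : ℂ) + 1) ^ (-s) - ((n : ℂ) + 2) ^ (-s)) =
      ∑ h ∈ Icc 1 k, risingFactorial s h / h.factorial * ((n : ℂ) + 2) ^ (-(s - α + h)) +
        ((((n : ℝ) + 2) ^ α : ℝ) : ℂ) * taylorRem (k + 1) s ((n : ℝ) + 2) 1 := by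
  have hn : (0 : ℝ) ≤ n := Nat.cast_nonneg _
  have hIcc : Icc 1 k = Ico (0 + 1) (k + 1) := by ext; simp
  rw [taylorRem, range_eq_Ico, sum_eq_sum_Ico_succ_bot (Nat.succ_pos k), ← hIcc]
  have e1 : ∀ h : ℕ, ((n : ℂ) + 2) ^ (-(s - α + h)) =
      ((((n : ℝ) + 2) ^ α : ℝ) : ℂ) * ((n : ℂ) + 2) ^ (-s - h) := by
    intro h
    have := ofReal_rpow_mul_cpow (by linarith : (0 : ℝ) < n + 2) α (-s - h)
    push_cast at this ⊢
    rw [this]; congr 1; ring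
  simp only [e1]
  rw [show (n : ℝ) + 2 - 1 = n + 1 by ring]
  simp only [risingFactorial, range_zero, prod_empty, Nat.factorial_zero, Nat.cast_one, div_one,
    Complex.ofReal_one, one_pow, mul_one, one_mul, Nat.cast_zero, sub_zero]
  push_cast
  rw [mul_sub, mul_sub, mul_add, mul_sum]
  have : ∀ h ∈ Icc 1 k, (∏ i ∈ range h, (s + (i : ℂ))) / (h.factorial : ℂ) *
      ((((n : ℝ) + 2) ^ α : ℝ) * ((n : ℂ) + 2) ^ (-s - h) : ℂ) = ((((n : ℝ) + 2) ^ α : ℝ) : ℂ) *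
      ((∏ i ∈ range h, (s + (i : ℂ))) / (h.factorial : ℂ) * ((n : ℂ) + 2) ^ (-s - h)) :=
    fun h _ => by ring
  rw [sum_congr rfl this]
  ring

lemma telescopeSum_exponent (α : ℝ) (k : ℕ) (s : ℂ) :
    α + 1 - ((k + 1 : ℕ) : ℝ) < s.re ↔ α - k < s.re := by
  push_cast
  rw [show α + 1 - ((k : ℝ) + 1) = α - k by ring]

lemma hasSum_telescopeSum {α : ℝ} (hα : 0 ≤ α) (k : ℕ) {s : ℂ} (hs : α < s.re) :
    HasSum (fun n : ℕ => ((((n : ℝ) + 2) ^ α : ℝ) : ℂ) *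
      (((n : ℂ) + 1) ^ (-s) - ((n : ℂ) + 2) ^ (-s))) (telescopeSum α k s) := by
  have hk : (0 : ℝ) ≤ k := Nat.cast_nonneg _
  simp only [add_two_rpow_mul_taylorRem α k]
  refine (hasSum_sum fun h hh => ?_).add
    ((isDerivLike_taylorRem (k + 1)).summable hα (abs_add_two_rpow_le hα) (by positivity)
      ((telescopeSum_exponent α k s).2 (by linarith))).hasSum
  refine (hasSum_add_two_cpow ?_).mul_left _
  have : (1 : ℝ) ≤ h := by exact_mod_cast (mem_Icc.1 hh).1
  simp
  linarith

lemma analyticAt_riemannZeta {s : ℂ} (hs : s ≠ 1) : AnalyticAt ℂ riemannZeta s :=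
  analyticAt_iff_eventually_differentiableAt.2 <|
    (isOpen_ne.mem_nhds hs : {1}ᶜ ∈ nhds s) |> Filter.mem_of_superset <|
      fun _ hz => differentiableAt_riemannZeta hz

lemma analyticAt_telescopeSum_term (α : ℝ) {h : ℕ} {s : ℂ} (hne : s - α + h ≠ 1) :
    AnalyticAt ℂ (fun s => risingFactorial s h / h.factorial * (riemannZeta (s - α + h) - 1))
      s := by
  have h1 : AnalyticAt ℂ (fun s => risingFactorial s h) s :=
    (differentiable_risingFactorial h).analyticAt s
  have h2 : AnalyticAt ℂ (fun s => riemannZeta (s - α + h)) s :=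
    (analyticAt_riemannZeta hne).comp (f := fun s : ℂ => s - α + h) (by fun_prop)
  exact (h1.div_const).mul (h2.sub analyticAt_const)

lemma analyticAt_telescopeSum_rem {α : ℝ} (hα : 0 ≤ α) {k : ℕ} {s : ℂ} (hs : α - k < s.re) :
    AnalyticAt ℂ (fun s => ∑' n : ℕ, ((((n : ℝ) + 2) ^ α : ℝ) : ℂ) *
      taylorRem (k + 1) s ((n : ℝ) + 2) 1) s :=
  (isDerivLike_taylorRem (k + 1)).analyticAt_tsum hα (abs_add_two_rpow_le hα)
    (by positivity) ((telescopeSum_exponent α k s).2 hs)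

lemma analyticAt_telescopeSum {α : ℝ} (hα : 0 ≤ α) {k : ℕ} {s : ℂ} (hs : α - k < s.re)
    (hne : ∀ h ∈ Icc 1 k, s - α + h ≠ 1) : AnalyticAt ℂ (telescopeSum α k) s :=
  (Finset.analyticAt_fun_sum _ fun h hh => analyticAt_telescopeSum_term α (hne h hh)).add
    (analyticAt_telescopeSum_rem hα hs)

lemma tendsto_natCast_add_cpow_neg {s : ℂ} (hs : 0 < s.re) (c : ℕ) :
    Tendsto (fun N : ℕ => ((N : ℂ) + c + 1) ^ (-s)) atTop (nhds 0) := by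
  rw [tendsto_zero_iff_norm_tendsto_zero]
  have h1 := (tendsto_rpow_neg_atTop hs).comp
    (tendsto_natCast_atTop_atTop.comp (tendsto_add_atTop_nat (c + 1)))
  refine h1.congr fun N => ?_
  have : (N : ℂ) + c + 1 = ((N + (c + 1) : ℕ) : ℝ) := by push_cast; ring
  rw [Function.comp_apply, Function.comp_apply, this,
    Complex.norm_cpow_eq_rpow_re_of_pos (by positivity), Complex.neg_re]

lemma tendsto_sum_cpow_sub_cpow {s : ℂ} (hs : 0 < s.re) :
    Tendsto (fun N => ∑ n ∈ range N, (((n : ℂ) + 1) ^ (-s) - ((n : ℂ) + 2) ^ (-s))) atTop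
      (nhds 1) := by
  have e : ∀ N : ℕ, ∑ n ∈ range N, (((n : ℂ) + 1) ^ (-s) - ((n : ℂ) + 2) ^ (-s)) =
      1 - ((N : ℂ) + 1) ^ (-s) := by
    intro N
    have := sum_range_sub' (fun n : ℕ => ((n : ℂ) + 1) ^ (-s)) N
    simp only [Nat.cast_zero, zero_add, Complex.one_cpow] at this
    rw [← this]
    refine sum_congr rfl fun n _ => ?_
    push_cast
    rw [add_assoc (n : ℂ) 1 1, one_add_one_eq_two]
  simp only [e]
  have := (tendsto_natCast_add_cpow_neg hs 0).const_sub 1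
  simpa using this

lemma telescopeSum_zero_of_re_pos (k : ℕ) {s : ℂ} (hs : 0 < s.re) : telescopeSum 0 k s = 1 := by
  have h := (hasSum_telescopeSum le_rfl k hs).tendsto_sum_nat
  refine tendsto_nhds_unique h ?_
  simpa using tendsto_sum_cpow_sub_cpow hs

/-- The telescoping series with `α = 0` has the value `1` off the real axis, by analytic
continuation along each of the two quarter-planes. -/
lemma telescopeSum_zero (k : ℕ) {s : ℂ} (hs : -(k : ℝ) < s.re) (him : s.im ≠ 0) :
    telescopeSum 0 k s = 1 := by
  set U : Set ℂ := {z : ℂ | -(k : ℝ) < z.re} ∩ {z : ℂ | 0 < s.im * z.im} with hU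
  have hUc : Convex ℝ U := by
    refine (convex_halfSpace_re_gt _).inter ?_
    intro z hz w hw a b ha hb hab
    simp only [Set.mem_ofPred_eq, Complex.add_im, Complex.real_smul,
      Complex.im_ofReal_mul] at hz hw ⊢
    rcases ha.eq_or_lt with rfl | ha'
    · rw [zero_add] at hab; subst hab; simpa using hw
    · nlinarith [mul_pos ha' hz, mul_nonneg hb hw.le]
  have han : AnalyticOnNhd ℂ (telescopeSum 0 k) U := by
    intro z hz
    refine analyticAt_telescopeSum le_rfl (by simpa using hz.1) (fun h _ e => ?_)
    have : z.im = 0 := by simpa using congrArg Complex.im e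
    have h2 : 0 < s.im * z.im := hz.2
    rw [this] at h2; simp at h2
  have hsU : s ∈ U := ⟨hs, mul_self_pos.2 him⟩
  set w : ℂ := ⟨1, s.im⟩ with hw
  have hk : (0 : ℝ) ≤ k := Nat.cast_nonneg _
  have hwU : w ∈ U := by
    refine ⟨?_, mul_self_pos.2 him⟩
    show -(k : ℝ) < 1
    linarith
  have hev : telescopeSum 0 k =ᶠ[nhds w] fun _ => 1 := by
    have : {z : ℂ | 0 < z.re} ∈ nhds w :=
      (isOpen_lt continuous_const Complex.continuous_re).mem_nhds (by simp [hw])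
    filter_upwards [this] with z hz using telescopeSum_zero_of_re_pos k hz
  exact han.eqOn_of_preconnected_of_eventuallyEq analyticOnNhd_const hUc.isPreconnected hwU hev hsU

lemma norm_riemannZeta_le_of_one_lt {ε : ℝ} (hε : 0 < ε) :
    ∃ C, 0 ≤ C ∧ ∀ w : ℂ, 1 + ε ≤ w.re → ‖riemannZeta w‖ ≤ C := by
  have hsum : Summable fun n : ℕ => ((n : ℝ) + 1) ^ (-(1 + ε)) := IsDerivLike.summable_rpow hε
  refine ⟨∑' n : ℕ, ((n : ℝ) + 1) ^ (-(1 + ε)), tsum_nonneg fun n => by positivity, fun w hw => ?_⟩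
  rw [zeta_eq_tsum_one_div_nat_add_one_cpow (by linarith)]
  refine tsum_of_norm_bounded hsum.hasSum fun n => ?_
  have hn : (1 : ℝ) ≤ (n : ℝ) + 1 := by linarith [(Nat.cast_nonneg n : (0 : ℝ) ≤ n)]
  have : (n : ℂ) + 1 = (((n : ℝ) + 1 : ℝ) : ℂ) := by push_cast; rfl
  rw [this, one_div, ← Complex.cpow_neg, Complex.norm_cpow_eq_rpow_re_of_pos (by linarith)]
  exact Real.rpow_le_rpow_of_exponent_le hn (by rw [Complex.neg_re]; linarith)

lemma one_le_norm_of_one_le_abs_im {s : ℂ} (h : 1 ≤ |s.im|) : 1 ≤ ‖s‖ :=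
  h.trans (Complex.abs_im_le_norm s)

/-- A term of `telescopeSum` inherits polynomial growth from the zeta function. -/
lemma norm_risingFactorial_mul_riemannZeta_le {s w : ℂ} {c : ℝ} (hs : 1 ≤ ‖s‖)
    (hw : ‖w‖ ≤ (1 + c) * ‖s‖) {C : ℝ} (hC : 0 ≤ C) {h m : ℕ}
    (hz : ‖riemannZeta w‖ ≤ C * ‖w‖ ^ m) :
    ‖risingFactorial s h / h.factorial * (riemannZeta w - 1)‖ ≤
      ((1 + h : ℝ) ^ h * (C * (1 + c) ^ m + 1)) * ‖s‖ ^ (h + m) := by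
  have hfac : (1 : ℝ) ≤ (h.factorial : ℝ) := by exact_mod_cast h.factorial_pos
  have h1 : ‖risingFactorial s h / h.factorial‖ ≤ (1 + h : ℝ) ^ h * ‖s‖ ^ h := by
    rw [norm_div, Complex.norm_natCast]
    exact (div_le_self (norm_nonneg _) hfac).trans (norm_risingFactorial_le_of_one_le hs h)
  have h2 : ‖riemannZeta w - 1‖ ≤ (C * (1 + c) ^ m + 1) * ‖s‖ ^ m := by
    refine (norm_sub_le _ _).trans ?_
    have h3 : ‖w‖ ^ m ≤ (1 + c) ^ m * ‖s‖ ^ m := by rw [← mul_pow]; gcongr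
    have h4 : 1 ≤ ‖s‖ ^ m := one_le_pow₀ hs
    have h5 : C * ‖w‖ ^ m ≤ C * ((1 + c) ^ m * ‖s‖ ^ m) := by gcongr
    rw [norm_one]
    nlinarith
  rw [norm_mul]
  calc _ ≤ ((1 + h : ℝ) ^ h * ‖s‖ ^ h) * ((C * (1 + c) ^ m + 1) * ‖s‖ ^ m) := by gcongr
    _ = _ := by rw [pow_add]; ring

/-- The remainder series of `telescopeSum` grows at most like `‖s‖ ^ (k + 1)`. -/
lemma exists_norm_telescopeSum_rem_le {α : ℝ} (hα : 0 ≤ α) (k : ℕ) {ε : ℝ} (hε : 0 < ε) :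
    ∃ D, 0 ≤ D ∧ ∀ s : ℂ, α - k + ε ≤ s.re → 1 ≤ ‖s‖ →
      ‖∑' n : ℕ, ((((n : ℝ) + 2) ^ α : ℝ) : ℂ) * taylorRem (k + 1) s ((n : ℝ) + 2) 1‖ ≤
        D * ‖s‖ ^ (k + 1) := by
  obtain ⟨D, hD0, hD⟩ := (isDerivLike_taylorRem (k + 1)).exists_norm_tsum_le hα
    (abs_add_two_rpow_le hα) (by positivity) hε
  refine ⟨D * (1 + (k + 1 : ℕ) : ℝ) ^ (k + 1), by positivity, fun s hs h1 => ?_⟩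
  refine (hD s (by push_cast; linarith)).trans ?_
  rw [mul_assoc]
  gcongr
  exact norm_risingFactorial_le_of_one_le h1 _

/-- Polynomial growth of the zeta function to the right of `Re w = 1 - K`. In the identity
`telescopeSum 0 K (w - 1) = 1` the first term is `(w - 1) ζ(w)`, and the others involve the zeta
function further to the right only. -/
lemma exists_norm_riemannZeta_le (K : ℕ) : ∀ ε : ℝ, 0 < ε → ∃ C, 0 ≤ C ∧ ∀ w : ℂ,
    ε - K + 1 ≤ w.re → 1 ≤ |w.im| → ‖riemannZeta w‖ ≤ C * ‖w‖ ^ K := by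
  induction K using Nat.strong_induction_on with
  | _ K ih =>
    intro ε hε
    rcases Nat.eq_zero_or_pos K with rfl | hK
    · obtain ⟨C, hC0, hC⟩ := norm_riemannZeta_le_of_one_lt hε
      refine ⟨C, hC0, fun w hw _ => ?_⟩
      rw [pow_zero, mul_one]
      exact hC w (by push_cast at hw; linarith)
    have ih' : ∀ h : ℕ, ∃ C, 0 ≤ C ∧ (2 ≤ h → h ≤ K → ∀ w : ℂ,
        ε - ((K + 1 - h : ℕ) : ℝ) + 1 ≤ w.re → 1 ≤ |w.im| →
          ‖riemannZeta w‖ ≤ C * ‖w‖ ^ (K + 1 - h)) := by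
      intro h
      by_cases hh : 2 ≤ h ∧ h ≤ K
      · obtain ⟨C, hC0, hC⟩ := ih (K + 1 - h) (by omega) ε hε
        exact ⟨C, hC0, fun _ _ => hC⟩
      · exact ⟨0, le_rfl, fun h1 h2 => absurd ⟨h1, h2⟩ hh⟩
    choose c hc0 hc using ih'
    obtain ⟨D, hD0, hD⟩ := exists_norm_telescopeSum_rem_le le_rfl K hε
    set b : ℕ → ℝ := fun h => (1 + h : ℝ) ^ h * (c h * (1 + h : ℝ) ^ (K + 1 - h) + 1) with hb
    have hb0 : ∀ h, 0 ≤ b h := fun h => by have := hc0 h; positivity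
    refine ⟨(2 + ∑ h ∈ Icc 2 K, b h + D) * 2 ^ K, ?_, fun w hw him => ?_⟩
    · have : 0 ≤ ∑ h ∈ Icc 2 K, b h := sum_nonneg fun h _ => hb0 h
      positivity
    set s : ℂ := w - 1 with hs
    have hsim : s.im = w.im := by simp [hs]
    have hsre : s.re = w.re - 1 := by simp [hs]
    have hs1 : 1 ≤ ‖s‖ := one_le_norm_of_one_le_abs_im (by rwa [hsim])
    have hw1 : 1 ≤ ‖w‖ := one_le_norm_of_one_le_abs_im him
    have hid := telescopeSum_zero K (s := s) (by rw [hsre]; linarith) (by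
      rw [hsim]; intro h0; rw [h0] at him; norm_num at him)
    have hIcc : Icc 1 K = insert 1 (Icc 2 K) := by
      ext h; simp only [mem_Icc, mem_insert]; omega
    rw [telescopeSum, hIcc, sum_insert (by simp)] at hid
    set R := ∑' n : ℕ, ((((n : ℝ) + 2) ^ (0 : ℝ) : ℝ) : ℂ) *
      taylorRem (K + 1) s ((n : ℝ) + 2) 1 with hR
    have hRle : ‖R‖ ≤ D * ‖s‖ ^ (K + 1) := hD s (by rw [hsre]; linarith) hs1
    set T := ∑ h ∈ Icc 2 K, risingFactorial s h / h.factorial *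
      (riemannZeta (s - (0 : ℝ) + h) - 1) with hT
    have hTle : ‖T‖ ≤ (∑ h ∈ Icc 2 K, b h) * ‖s‖ ^ (K + 1) := by
      rw [sum_mul]
      refine norm_sum_le_of_le _ fun h hh => ?_
      rw [mem_Icc] at hh
      have hh0 : (0 : ℝ) ≤ h := Nat.cast_nonneg _
      have := norm_risingFactorial_mul_riemannZeta_le (s := s) (w := s - (0 : ℝ) + h) (c := h)
        hs1 ?_ (hc0 h) (h := h) (m := K + 1 - h) ?_
      · rwa [show h + (K + 1 - h) = K + 1 by omega] at this
      · refine (norm_add_le _ _).trans ?_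
        rw [Complex.norm_natCast, Complex.ofReal_zero, sub_zero]
        nlinarith
      · refine hc h hh.1 hh.2 _ ?_ ?_
        · rw [Nat.cast_sub (by omega)]
          push_cast
          simp [hsre]
          linarith
        · simpa [hsim] using him
    have hmain : s * riemannZeta w = 1 + s - T - R := by
      have e1 : risingFactorial s 1 / (Nat.factorial 1 : ℂ) = s := by simp [risingFactorial]
      have e2 : s - (0 : ℝ) + ((1 : ℕ) : ℂ) = w := by simp [hs]
      rw [e1, e2] at hid
      linear_combination hid
    have hpow : ‖s‖ ≤ ‖s‖ ^ (K + 1) := le_self_pow₀ hs1 (by omega)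
    have h1 : ‖s‖ * ‖riemannZeta w‖ ≤ (2 + ∑ h ∈ Icc 2 K, b h + D) * ‖s‖ ^ (K + 1) := by
      rw [← norm_mul, hmain]
      calc _ ≤ 1 + ‖s‖ + ‖T‖ + ‖R‖ := by
            refine (norm_sub_le _ _).trans (add_le_add_left ((norm_sub_le _ _).trans
              (add_le_add_left ((norm_add_le _ _).trans (by rw [norm_one])) _)) _)
        _ ≤ _ := by nlinarith
    have h2 : ‖riemannZeta w‖ ≤ (2 + ∑ h ∈ Icc 2 K, b h + D) * ‖s‖ ^ K := by
      rw [pow_succ'] at h1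
      have hs0 : 0 < ‖s‖ := by linarith
      refine le_of_mul_le_mul_left (h1.trans (le_of_eq ?_)) hs0
      ring
    refine h2.trans ?_
    rw [mul_assoc, ← mul_pow]
    have : 0 ≤ ∑ h ∈ Icc 2 K, b h := sum_nonneg fun h _ => hb0 h
    gcongr
    calc ‖s‖ ≤ ‖w‖ + ‖(1 : ℂ)‖ := norm_sub_le _ _
      _ ≤ 2 * ‖w‖ := by rw [norm_one]; linarith

/-- The continued telescoping series grows at most like `‖s‖ ^ (k + 1)`. -/
lemma exists_norm_telescopeSum_le {α : ℝ} (hα : 0 ≤ α) (k : ℕ) {ε : ℝ} (hε : 0 < ε) :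
    ∃ C, 0 ≤ C ∧ ∀ s : ℂ, α - k + ε ≤ s.re → 1 ≤ |s.im| →
      ‖telescopeSum α k s‖ ≤ C * ‖s‖ ^ (k + 1) := by
  choose c hc0 hc using fun h : ℕ => exists_norm_riemannZeta_le (k + 1 - h) ε hε
  obtain ⟨D, hD0, hD⟩ := exists_norm_telescopeSum_rem_le hα k hε
  set b : ℕ → ℝ := fun h => (1 + h : ℝ) ^ h * (c h * (1 + (α + h) : ℝ) ^ (k + 1 - h) + 1) with hb
  have hb0 : ∀ h, 0 ≤ b h := fun h => by have := hc0 h; positivity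
  have hb1 : 0 ≤ ∑ h ∈ Icc 1 k, b h := sum_nonneg fun h _ => hb0 h
  refine ⟨∑ h ∈ Icc 1 k, b h + D, by positivity, fun s hs him => ?_⟩
  have hs1 : 1 ≤ ‖s‖ := one_le_norm_of_one_le_abs_im him
  refine (norm_add_le _ _).trans ?_
  rw [add_mul, sum_mul]
  refine add_le_add (norm_sum_le_of_le _ fun h hh => ?_) (hD s hs hs1)
  rw [mem_Icc] at hh
  have hh0 : (0 : ℝ) ≤ h := Nat.cast_nonneg _
  have := norm_risingFactorial_mul_riemannZeta_le (s := s) (w := s - α + h) (c := α + h)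
    hs1 ?_ (hc0 h) (h := h) (m := k + 1 - h) ?_
  · rwa [show h + (k + 1 - h) = k + 1 by omega] at this
  · refine (norm_add_le _ _).trans ((add_le_add_left (norm_sub_le _ _) _).trans ?_)
    rw [Complex.norm_natCast, Complex.norm_real, Real.norm_eq_abs, abs_of_nonneg hα]
    nlinarith
  · refine hc h _ ?_ ?_
    · rw [Nat.cast_sub (by omega)]
      push_cast
      simp
      linarith
    · simpa using him

/-! ### The counting function of the values `⌊n ^ κ⌋` and the Piatetski-Shapiro series -/

lemma floor_rpow_eq_iff {κ α : ℝ} (hκ : 0 < κ) (hα : α = 1 / κ) (n m : ℕ) :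
    ⌊(n : ℝ) ^ κ⌋₊ = m ↔ ⌈(m : ℝ) ^ α⌉₊ ≤ n ∧ n < ⌈((m + 1 : ℕ) : ℝ) ^ α⌉₊ := by
  have hκα : κ * α = 1 := by rw [hα]; field_simp
  have hα0 : 0 < α := by rw [hα]; positivity
  have hn : (n : ℝ) = ((n : ℝ) ^ κ) ^ α := by
    rw [← Real.rpow_mul (Nat.cast_nonneg n), hκα, Real.rpow_one]
  rw [Nat.floor_eq_iff (by positivity), Nat.ceil_le, Nat.lt_ceil]
  conv_rhs => rw [hn]
  rw [Real.rpow_le_rpow_iff (by positivity) (by positivity) hα0,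
    Real.rpow_lt_rpow_iff (by positivity) (by positivity) hα0]
  push_cast
  rfl

lemma natCeil_rpow_mono {α : ℝ} (hα : 0 ≤ α) {m n : ℕ} (h : m ≤ n) :
    ⌈(m : ℝ) ^ α⌉₊ ≤ ⌈(n : ℝ) ^ α⌉₊ :=
  Nat.ceil_mono (Real.rpow_le_rpow (Nat.cast_nonneg m) (by exact_mod_cast h) hα)

lemma one_le_natCeil_rpow {α : ℝ} (hα : 0 ≤ α) (m : ℕ) : 1 ≤ ⌈((m + 1 : ℕ) : ℝ) ^ α⌉₊ := by
  have := natCeil_rpow_mono hα (Nat.le_add_left 1 m)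
  simpa using this

/-- Grouping the terms of the Piatetski-Shapiro series according to the value of `⌊n ^ κ⌋`. -/
lemma sum_psZetaTerm {κ α : ℝ} (hκ : 0 < κ) (hα : α = 1 / κ) (s : ℂ) (M : ℕ) :
    ∑ n ∈ range (⌈((M + 1 : ℕ) : ℝ) ^ α⌉₊ - 1), psZetaTerm κ s n =
      ∑ m ∈ range M, ((⌈((m + 2 : ℕ) : ℝ) ^ α⌉₊ : ℂ) - ⌈((m + 1 : ℕ) : ℝ) ^ α⌉₊) *
        ((m : ℂ) + 1) ^ (-s) := by
  have hα0 : 0 < α := by rw [hα]; positivity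
  induction M with
  | zero => simp
  | succ M ih =>
    set a := ⌈((M + 1 : ℕ) : ℝ) ^ α⌉₊ with ha
    set b := ⌈((M + 1 + 1 : ℕ) : ℝ) ^ α⌉₊ with hb
    have h1 : 1 ≤ a := one_le_natCeil_rpow hα0.le M
    have hab : a ≤ b := natCeil_rpow_mono hα0.le (Nat.le_succ _)
    rw [sum_range_succ, ← ih, ← sum_range_add_sum_Ico _ (Nat.sub_le_sub_right hab 1)]
    congr 1
    rw [sum_congr rfl (g := fun _ => ((M : ℂ) + 1) ^ (-s)) (fun n hn => ?_)]
    · rw [sum_const, Nat.card_Ico, nsmul_eq_mul, show b - 1 - (a - 1) = b - a by omega,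
        Nat.cast_sub hab]
    · rw [mem_Ico] at hn
      have := (floor_rpow_eq_iff hκ hα (n + 1) (M + 1)).2 ⟨by omega, by omega⟩
      rw [psZetaTerm, this, one_div, ← Complex.cpow_neg]
      push_cast; rfl

lemma summable_psZetaTerm {κ : ℝ} (hκ : 0 < κ) {s : ℂ} (hs : 1 / κ < s.re) :
    Summable (psZetaTerm κ s) := by
  have hs0 : 0 < s.re := lt_trans (by positivity) hs
  have hκs : 0 < κ * s.re - 1 := by
    rw [div_lt_iff₀ hκ] at hs; linarith
  refine Summable.of_norm_bounded
    ((IsDerivLike.summable_rpow hκs).mul_left ((2 : ℝ) ^ s.re)) fun n => ?_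
  have hn1 : (1 : ℝ) ≤ ((n + 1 : ℕ) : ℝ) := by
    push_cast; linarith [(Nat.cast_nonneg n : (0 : ℝ) ≤ n)]
  have hx : (1 : ℝ) ≤ ((n + 1 : ℕ) : ℝ) ^ κ := Real.one_le_rpow hn1 hκ.le
  have hf1 : 1 ≤ ⌊((n + 1 : ℕ) : ℝ) ^ κ⌋₊ := Nat.le_floor (by simpa using hx)
  have hf1R : (1 : ℝ) ≤ (⌊((n + 1 : ℕ) : ℝ) ^ κ⌋₊ : ℝ) := by exact_mod_cast hf1
  have hf : ((n + 1 : ℕ) : ℝ) ^ κ / 2 ≤ (⌊((n + 1 : ℕ) : ℝ) ^ κ⌋₊ : ℝ) := by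
    have := Nat.lt_floor_add_one (((n + 1 : ℕ) : ℝ) ^ κ)
    linarith
  rw [psZetaTerm, one_div, ← Complex.cpow_neg, Complex.norm_natCast_cpow_of_pos hf1, Complex.neg_re]
  refine (Real.rpow_le_rpow_of_nonpos (by linarith) hf (by linarith)).trans (le_of_eq ?_)
  rw [Real.div_rpow (by linarith) (by norm_num), ← Real.rpow_mul (by linarith),
    Real.rpow_neg (by norm_num : (0 : ℝ) ≤ 2), div_inv_eq_mul, mul_comm]
  congr 1
  push_cast
  congr 1
  ring

lemma hasSum_psZetaTerm {κ α : ℝ} (hκ : 0 < κ) (hα : α = 1 / κ) {s z : ℂ} (hs : 1 / κ < s.re)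
    (h : Tendsto (fun M => ∑ m ∈ range M,
      ((⌈((m + 2 : ℕ) : ℝ) ^ α⌉₊ : ℂ) - ⌈((m + 1 : ℕ) : ℝ) ^ α⌉₊) * ((m : ℂ) + 1) ^ (-s))
      atTop (nhds z)) : HasSum (psZetaTerm κ s) z := by
  have hα0 : 0 < α := by rw [hα]; positivity
  have hsum := (summable_psZetaTerm hκ hs).hasSum
  have hA : Tendsto (fun M : ℕ => ⌈((M + 1 : ℕ) : ℝ) ^ α⌉₊ - 1) atTop atTop := by
    refine (tendsto_sub_atTop_nat 1).comp ?_
    refine tendsto_nat_ceil_atTop.comp ((tendsto_rpow_atTop hα0).comp ?_)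
    exact tendsto_natCast_atTop_atTop.comp (tendsto_add_atTop_nat 1)
  have h2 := hsum.tendsto_sum_nat.comp hA
  have h3 := tendsto_nhds_unique (h2.congr fun M => sum_psZetaTerm hκ hα s M) h
  rwa [h3] at hsum

/-! ### Simple poles coming from the Riemann zeta function -/

/-- A function of the form `c(z) ζ(z - p + 1) + g(z)` has a simple pole at `p` with residue
`c(p)`. -/
lemma hasSimplePoleWithResidue {f c g : ℂ → ℂ} {p : ℂ} (hc : AnalyticAt ℂ c p)
    (hg : AnalyticAt ℂ g p) (hcp : c p ≠ 0)
    (hf : ∀ z, z ≠ p → f z = c z * riemannZeta (z - p + 1) + g z) :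
    HasSimplePoleWithResidue f p (c p) := by
  -- `(z - 1) ζ(z)` with its singularity removed
  set R : ℂ → ℂ := Function.update (fun z => (z - 1) * riemannZeta z) 1 1 with hR
  have hRan : AnalyticAt ℂ R 1 := by
    refine Complex.analyticAt_of_differentiable_on_punctured_nhds_of_continuousAt ?_ ?_
    · filter_upwards [self_mem_nhdsWithin] with z hz
      have hz' : z ≠ 1 := hz
      have h1 : DifferentiableAt ℂ (fun z => (z - 1) * riemannZeta z) z :=
        ((differentiableAt_id).sub_const 1).mul (differentiableAt_riemannZeta hz')
      refine h1.congr_of_eventuallyEq ?_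
      filter_upwards [isOpen_ne.mem_nhds hz'] with w hw
      exact Function.update_of_ne hw _ _
    · rw [hR, continuousAt_update_same]
      exact riemannZeta_residue_one
  have hRp : AnalyticAt ℂ (fun z => R (z - p + 1)) p := by
    have h1 : AnalyticAt ℂ (fun z : ℂ => z - p + 1) p := by fun_prop
    refine AnalyticAt.fun_comp ?_ h1
    simpa using hRan
  set G : ℂ → ℂ := fun z => c z * R (z - p + 1) + (z - p) * g z with hG
  have hGan : AnalyticAt ℂ G p :=
    (hc.mul hRp).add (((analyticAt_id).sub analyticAt_const).mul hg)
  have hGp : G p = c p := by simp [hG, hR]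
  have hfG : ∀ z, z ≠ p → (z - p) * f z = G z := by
    intro z hz
    have hz' : z - p + 1 ≠ 1 := by simpa [sub_eq_zero] using hz
    simp only [hG, hR]
    rw [Function.update_of_ne hz', hf z hz]
    ring
  have hfG' : ∀ z, z ≠ p → f z = (z - p) ^ (-1 : ℤ) • G z := by
    intro z hz
    have : z - p ≠ 0 := sub_ne_zero.2 hz
    rw [← hfG z hz, smul_eq_mul, zpow_neg_one]
    field_simp
  have hmer : MeromorphicAt f p := by
    have h1 : MeromorphicAt (fun z => (z - p) ^ (-1 : ℤ) • G z) p :=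
      (((analyticAt_id).sub analyticAt_const).meromorphicAt.zpow (-1)).smul hGan.meromorphicAt
    refine h1.congr ?_
    filter_upwards [self_mem_nhdsWithin] with z hz using (hfG' z hz).symm
  refine ⟨hmer, ?_, ?_⟩
  · have := (meromorphicOrderAt_eq_int_iff hmer (n := -1)).2 ⟨G, hGan, by rwa [hGp], by
      filter_upwards [self_mem_nhdsWithin] with z hz using hfG' z hz⟩
    simpa using this
  · have h1 : Tendsto G (nhdsWithin p {p}ᶜ) (nhds (c p)) := by
      rw [← hGp]
      exact hGan.continuousAt.tendsto.mono_left nhdsWithin_le_nhds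
    refine h1.congr' ?_
    filter_upwards [self_mem_nhdsWithin] with z hz using (hfG z hz).symm

/-! ### Integral `1 / κ` -/

/-- The finite sum of shifted zeta functions to which the Piatetski-Shapiro series reduces when
`1 / κ = a` is an integer. -/
noncomputable def binomialZeta (a : ℕ) (s : ℂ) : ℂ :=
  ∑ j ∈ range a, (a.choose j : ℂ) * riemannZeta (s - j)

lemma natInd_natCast (a : ℕ) : natInd (a : ℝ) = 1 :=
  Set.indicator_of_mem (Set.mem_range_self a) _

lemma hasSum_binomialZeta {κ : ℝ} (hκ : 0 < κ) {a : ℕ} (ha : (a : ℝ) = 1 / κ) {s : ℂ}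
    (hs : 1 / κ < s.re) : HasSum (psZetaTerm κ s) (binomialZeta a s) := by
  refine hasSum_psZetaTerm hκ ha hs ?_
  have hterm : ∀ j ∈ range a, HasSum (fun m : ℕ => (a.choose j : ℂ) * ((m : ℂ) + 1) ^ (-(s - j)))
      ((a.choose j : ℂ) * riemannZeta (s - j)) := by
    intro j hj
    have hj' : (j : ℝ) + 1 ≤ a := by exact_mod_cast mem_range.1 hj
    have hre : 1 < (s - j).re := by
      rw [Complex.sub_re, Complex.natCast_re]; linarith
    have hsum : Summable fun n : ℕ => 1 / ((n : ℂ) + 1) ^ (s - j) := by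
      have := (summable_nat_add_iff 1).2 (Complex.summable_one_div_nat_cpow.2 hre)
      simpa using this
    have := hsum.hasSum
    rw [← zeta_eq_tsum_one_div_nat_add_one_cpow hre] at this
    simp only [one_div, ← Complex.cpow_neg] at this
    exact this.mul_left _
  refine ((hasSum_sum hterm).tendsto_sum_nat).congr fun M => sum_congr rfl fun m _ => ?_
  have hm0 : ((m : ℂ) + 1) ≠ 0 := by exact_mod_cast m.succ_ne_zero
  have e : ∀ n : ℕ, ⌈(n : ℝ) ^ (a : ℝ)⌉₊ = n ^ a := fun n => by
    rw [Real.rpow_natCast, ← Nat.cast_pow, Nat.ceil_natCast]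
  rw [e, e]
  push_cast
  have e2 : ((m : ℂ) + 2) ^ a - ((m : ℂ) + 1) ^ a =
      ∑ j ∈ range a, (a.choose j : ℂ) * ((m : ℂ) + 1) ^ j := by
    have := add_pow ((m : ℂ) + 1) 1 a
    rw [add_assoc (m : ℂ), one_add_one_eq_two, sum_range_succ] at this
    simp only [one_pow, mul_one, Nat.choose_self, Nat.cast_one] at this
    rw [this, add_sub_cancel_right]
    exact sum_congr rfl fun j _ => mul_comm _ _
  rw [e2, sum_mul]
  refine sum_congr rfl fun j _ => ?_
  rw [mul_assoc, show -(s - (j : ℂ)) = (j : ℂ) + -s by ring, Complex.cpow_add _ _ hm0,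
    Complex.cpow_natCast]

lemma analyticAt_binomialZeta {a : ℕ} {s : ℂ} (hs : ∀ j < a, s - j ≠ 1) :
    AnalyticAt ℂ (binomialZeta a) s := by
  refine Finset.analyticAt_fun_sum _ fun j hj => ?_
  have : AnalyticAt ℂ (fun s : ℂ => riemannZeta (s - j)) s :=
    (analyticAt_riemannZeta (hs j (mem_range.1 hj))).comp (f := fun s : ℂ => s - j) (by fun_prop)
  exact analyticAt_const.mul this

lemma hasSimplePole_binomialZeta {a h : ℕ} (hh : h < a) :
    HasSimplePoleWithResidue (binomialZeta a) (((a : ℝ) - h : ℝ) : ℂ)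
      ((Real.Gamma (a + 1) / (((h + 1).factorial : ℝ) * Real.Gamma ((a : ℝ) - h)) : ℝ) : ℂ) := by
  obtain ⟨j, rfl⟩ : ∃ j, a = j + h + 1 := ⟨a - h - 1, by omega⟩
  have hp : ((((j + h + 1 : ℕ) : ℝ) - h : ℝ) : ℂ) = (j : ℂ) + 1 := by push_cast; ring
  have hres : ((Real.Gamma (((j + h + 1 : ℕ) : ℝ) + 1) / (((h + 1).factorial : ℝ) *
      Real.Gamma (((j + h + 1 : ℕ) : ℝ) - h)) : ℝ) : ℂ) = ((j + h + 1).choose j : ℂ) := by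
    have e : ((j + h + 1 : ℕ) : ℝ) - h = j + 1 := by push_cast; ring
    rw [e, Real.Gamma_nat_eq_factorial, Real.Gamma_nat_eq_factorial]
    have h1 := Nat.choose_mul_factorial_mul_factorial (show j ≤ j + h + 1 by omega)
    rw [show j + h + 1 - j = h + 1 by omega] at h1
    have h2 : ((h + 1).factorial : ℝ) * (j.factorial : ℝ) ≠ 0 := by positivity
    rw [show (((j + h + 1).choose j : ℕ) : ℂ) = (((j + h + 1).choose j : ℝ) : ℂ) by push_cast; rfl]
    congr 1
    rw [div_eq_iff h2, ← h1]
    push_cast; ring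
  rw [hp, hres]
  refine hasSimplePoleWithResidue (c := fun _ => ((j + h + 1).choose j : ℂ))
    (g := fun s => ∑ i ∈ (range (j + h + 1)).erase j,
      ((j + h + 1).choose i : ℂ) * riemannZeta (s - i)) analyticAt_const ?_ ?_ ?_
  · refine Finset.analyticAt_fun_sum _ fun i hi => ?_
    have hne : (j : ℂ) + 1 - i ≠ 1 := by
      intro e
      have : (j : ℂ) = i := by linear_combination e
      exact (mem_erase.1 hi).1 (by exact_mod_cast this.symm)
    have : AnalyticAt ℂ (fun s : ℂ => riemannZeta (s - i)) ((j : ℂ) + 1) :=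
      (analyticAt_riemannZeta hne).comp (f := fun s : ℂ => s - i) (by fun_prop)
    exact analyticAt_const.mul this
  · exact_mod_cast (Nat.choose_pos (by omega)).ne'
  · intro z _
    rw [binomialZeta, ← add_sum_erase _ _ (mem_range.2 (by omega : j < j + h + 1))]
    congr 3
    ring

lemma exists_norm_binomialZeta_le (a : ℕ) {ε : ℝ} (hε : 0 < ε) :
    ∃ C, ∀ s : ℂ, ε - 1 ≤ s.re → 1 ≤ |s.im| →
      ‖binomialZeta a s‖ ≤ C * (‖s‖ * (‖s‖ + 1) ^ (a + 1)) := by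
  obtain ⟨C, hC0, hC⟩ := exists_norm_riemannZeta_le (a + 1) ε hε
  refine ⟨∑ j ∈ range a, (a.choose j : ℝ) * (C * (1 + a) ^ (a + 1)), fun s hs him => ?_⟩
  have hs1 : 1 ≤ ‖s‖ := one_le_norm_of_one_le_abs_im him
  rw [sum_mul]
  refine norm_sum_le_of_le _ fun j hj => ?_
  have hj' : (j : ℝ) + 1 ≤ a := by exact_mod_cast mem_range.1 hj
  have hj0 : (0 : ℝ) ≤ j := Nat.cast_nonneg _
  rw [norm_mul, Complex.norm_natCast, mul_assoc]
  gcongr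
  have h1 := hC (s - j) (by
    rw [Complex.sub_re, Complex.natCast_re]; push_cast; linarith) (by simpa using him)
  refine h1.trans ?_
  rw [mul_assoc]
  gcongr
  calc ‖s - j‖ ^ (a + 1) ≤ ((1 + a) * (‖s‖ + 1)) ^ (a + 1) := by
        gcongr
        refine (norm_sub_le _ _).trans ?_
        rw [Complex.norm_natCast]
        nlinarith
    _ = (1 + a) ^ (a + 1) * (1 * (‖s‖ + 1) ^ (a + 1)) := by rw [mul_pow, one_mul]
    _ ≤ _ := by gcongr

/-- The value at `0` is a sum of Bernoulli numbers. -/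
lemma binomialZeta_zero (a : ℕ) : binomialZeta a 0 = -(a : ℂ) / (a + 1) := by
  have hB := sum_bernoulli' (a + 1)
  rw [sum_range_succ'] at hB
  simp only [Nat.choose_zero_right, bernoulli'_zero, Nat.cast_one, mul_one] at hB
  have ha : ((a : ℂ) + 1) ≠ 0 := by exact_mod_cast a.succ_ne_zero
  have hterm : ∀ j ∈ range a, (a.choose j : ℂ) * riemannZeta (0 - j) =
      -((((a + 1).choose (j + 1) : ℚ) * bernoulli' (j + 1) : ℚ) : ℂ) / (a + 1) := by
    intro j _
    have hj : ((j : ℂ) + 1) ≠ 0 := by exact_mod_cast j.succ_ne_zero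
    have h1 : ((a : ℂ) + 1) * (a.choose j : ℂ) = ((a + 1).choose (j + 1) : ℂ) * (j + 1) := by
      exact_mod_cast Nat.add_one_mul_choose_eq a j
    rw [zero_sub, riemannZeta_neg_nat_eq_bernoulli']
    push_cast
    field_simp
    linear_combination -(bernoulli' (j + 1) : ℂ) * h1
  rw [binomialZeta, sum_congr rfl hterm, ← sum_div, sum_neg_distrib, ← Rat.cast_sum]
  congr 2
  have : ∑ j ∈ range a, ((a + 1).choose (j + 1) : ℚ) * bernoulli' (j + 1) = a := by
    push_cast at hB; linarith
  rw [this]; simp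

lemma hasDerivAt_binomialZeta (a : ℕ) :
    HasDerivAt (binomialZeta a)
      (∑ h ∈ range a, (a.choose h : ℂ) * deriv riemannZeta (-(h : ℂ))) 0 := by
  refine HasDerivAt.fun_sum fun j _ => HasDerivAt.const_mul _ ?_
  have hne : (-(j : ℂ)) ≠ 1 := by
    intro e
    have : ((j + 1 : ℕ) : ℂ) = 0 := by push_cast; linear_combination -e
    exact j.succ_ne_zero (by exact_mod_cast this)
  have h1 := (differentiableAt_riemannZeta hne).hasDerivAt
  have h2 : HasDerivAt (fun s : ℂ => s - j) 1 0 := (hasDerivAt_id (0 : ℂ)).sub_const _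
  rw [show (-(j : ℂ)) = (fun s : ℂ => s - j) 0 by simp] at h1
  refine HasDerivAt.congr_deriv (h1.comp (0 : ℂ) h2) ?_
  simp

/-! ### Non-integral `1 / κ` -/

/-- The partial sums `∑ ⌈m ^ α⌉ - m ^ α - 1 / 2` over `2 ≤ m < n + 2`. -/
noncomputable def ceilDefectSum (α : ℝ) (n : ℕ) : ℝ := ∑ i ∈ range n, ceilDefect α (i + 2)

/-- The continuation of `∑ n, ceilDefect α (n + 2) * ((n + 1) ^ (-s) - (n + 2) ^ (-s))` beyond the
line `Re s = 0`, by summation by parts. -/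
noncomputable def ceilDefectSeries (α : ℝ) (s : ℂ) : ℂ :=
  ∑' n : ℕ, (ceilDefectSum α (n + 1) : ℂ) * secondDiff n s

/-- Summation by parts against the partial sums of `θ`. -/
lemma sum_mul_eq_sum_partialSum_mul (θ d : ℕ → ℂ) (N : ℕ) :
    ∑ n ∈ range N, θ n * d n =
      ∑ n ∈ range N, (∑ i ∈ range (n + 1), θ i) * (d n - d (n + 1)) +
        (∑ i ∈ range N, θ i) * d N := by
  induction N with
  | zero => simp
  | succ N ih =>
    rw [sum_range_succ, ih, sum_range_succ (fun n => (∑ i ∈ range (n + 1), θ i) * _),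
      sum_range_succ θ N]
    ring

lemma sum_ceilDefect_mul (α : ℝ) (d : ℕ → ℂ) (N : ℕ) :
    ∑ n ∈ range N, (ceilDefect α (n + 2) : ℂ) * d n =
      ∑ n ∈ range N, (ceilDefectSum α (n + 1) : ℂ) * (d n - d (n + 1)) +
        (ceilDefectSum α N : ℂ) * d N := by
  rw [sum_mul_eq_sum_partialSum_mul]
  simp only [ceilDefectSum]
  push_cast
  rfl

lemma exists_abs_ceilDefectSum_le {α : ℝ} (hα : 0 < α) (hn : ∀ a : ℕ, α ≠ a) :
    ∃ σ : ℝ, 0 < σ ∧ σ < 1 ∧ ∃ C : ℝ, 0 ≤ C ∧ ∀ n : ℕ,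
      |ceilDefectSum α (n + 1)| ≤ C * ((n : ℝ) + 1) ^ (1 - σ) := by
  obtain ⟨σ, hσ0, hσ1, C, hC0, hC⟩ := exists_sum_ceilDefect_le hα hn
  refine ⟨σ, hσ0, hσ1, 2 * C + 1, by positivity, fun n => ?_⟩
  have hn0 : (0 : ℝ) ≤ n := Nat.cast_nonneg _
  have h1 := hC (n + 2)
  rw [sum_range_succ'] at h1
  have h2 : ceilDefectSum α (n + 1) =
      (∑ i ∈ range (n + 1), ceilDefect α (i + 1 + 1) + ceilDefect α (0 + 1)) -
        ceilDefect α 1 := by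
    rw [ceilDefectSum]; simp [add_assoc]
  have h3 : ((n + 2 : ℕ) : ℝ) ^ (1 - σ) ≤ 2 * ((n : ℝ) + 1) ^ (1 - σ) := by
    calc ((n + 2 : ℕ) : ℝ) ^ (1 - σ) ≤ (2 * ((n : ℝ) + 1)) ^ (1 - σ) :=
          Real.rpow_le_rpow (by positivity) (by push_cast; linarith) (by linarith)
      _ = 2 ^ (1 - σ) * ((n : ℝ) + 1) ^ (1 - σ) := Real.mul_rpow (by norm_num) (by positivity)
      _ ≤ 2 * ((n : ℝ) + 1) ^ (1 - σ) := by
        gcongr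
        exact Real.rpow_le_self_of_one_le (by norm_num) (by linarith)
  have h4 : 1 ≤ ((n : ℝ) + 1) ^ (1 - σ) := Real.one_le_rpow (by linarith) (by linarith)
  rw [h2]
  refine (abs_sub _ _).trans ?_
  have h5 := abs_ceilDefect_le α 1
  have h6 : C * ((n + 2 : ℕ) : ℝ) ^ (1 - σ) ≤ C * (2 * ((n : ℝ) + 1) ^ (1 - σ)) := by gcongr
  nlinarith

/-- A boundary term in a summation by parts tends to `0`. -/
lemma tendsto_ceilDefectSum_mul {α σ C : ℝ} {d : ℕ → ℂ} {D e : ℝ}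
    (hU : ∀ n : ℕ, |ceilDefectSum α (n + 1)| ≤ C * ((n : ℝ) + 1) ^ (1 - σ)) (hC : 0 ≤ C)
    (hd : ∀ n, ‖d n‖ ≤ D * ((n : ℝ) + 1) ^ (-(1 + e))) (hD : 0 ≤ D) (hσe : 0 < σ + e)
    (he : -1 ≤ e) :
    Tendsto (fun N => (ceilDefectSum α N : ℂ) * d N) atTop (nhds 0) := by
  rw [← tendsto_add_atTop_iff_nat 1]
  have h1 : Tendsto (fun N : ℕ => C * D * ((N : ℝ) + 1) ^ (-(σ + e))) atTop (nhds 0) := by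
    have := ((tendsto_rpow_neg_atTop hσe).comp (tendsto_natCast_atTop_atTop.comp
      (tendsto_add_atTop_nat 1))).const_mul (C * D)
    rw [mul_zero] at this
    simpa [Function.comp_def] using this
  refine squeeze_zero_norm (fun N => ?_) h1
  have hN : (0 : ℝ) < (N : ℝ) + 1 := by positivity
  rw [norm_mul, Complex.norm_real, Real.norm_eq_abs]
  have h2 : ‖d (N + 1)‖ ≤ D * ((N : ℝ) + 1) ^ (-(1 + e)) := by
    refine (hd (N + 1)).trans ?_
    gcongr ?_ * ?_
    exact Real.rpow_le_rpow_of_nonpos hN (by push_cast; linarith) (by linarith)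
  calc _ ≤ (C * ((N : ℝ) + 1) ^ (1 - σ)) * (D * ((N : ℝ) + 1) ^ (-(1 + e))) :=
        mul_le_mul (hU N) h2 (norm_nonneg _) (by positivity)
    _ = C * D * (((N : ℝ) + 1) ^ (1 - σ + -(1 + e))) := by rw [Real.rpow_add hN]; ring
    _ = _ := by congr 2; ring

lemma taylorRem_one (s : ℂ) (n : ℕ) :
    taylorRem 1 s ((n : ℝ) + 2) 1 = ((n : ℂ) + 1) ^ (-s) - ((n : ℂ) + 2) ^ (-s) := by
  rw [taylorRem, sum_range_one, show (n : ℝ) + 2 - 1 = n + 1 by ring]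
  simp [risingFactorial]

lemma tendsto_sum_ceilDefect_mul {α σ C : ℝ} (hσ0 : 0 < σ) (hσ1 : σ < 1)
    (hU : ∀ n : ℕ, |ceilDefectSum α (n + 1)| ≤ C * ((n : ℝ) + 1) ^ (1 - σ)) (hC : 0 ≤ C)
    {s : ℂ} (hs : 0 < s.re) :
    Tendsto (fun N => ∑ n ∈ range N, (ceilDefect α (n + 2) : ℂ) *
      (((n : ℂ) + 1) ^ (-s) - ((n : ℂ) + 2) ^ (-s))) atTop (nhds (ceilDefectSeries α s)) := by
  have h1 := (isDerivLike_secondDiff.summable (by linarith : (0 : ℝ) ≤ 1 - σ) hU hC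
    (s := s) (by push_cast; linarith)).hasSum.tendsto_sum_nat
  have h2 := tendsto_ceilDefectSum_mul (D := 2 * ‖risingFactorial s 1‖) (e := s.re)
    (d := fun n => ((n : ℂ) + 1) ^ (-s) - ((n : ℂ) + 2) ^ (-s)) hU hC (fun n => ?_)
    (by positivity) (by linarith) (by linarith)
  · have h3 := h1.add h2
    rw [add_zero] at h3
    refine h3.congr fun N => ?_
    rw [sum_ceilDefect_mul]
    congr 1
    refine sum_congr rfl fun n _ => ?_
    rw [secondDiff]
    push_cast
    ring_nf
  · rw [← taylorRem_one]
    have := (isDerivLike_taylorRem 1).norm_le n s (by push_cast; linarith)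
    rw [Nat.cast_one, add_comm s.re] at this
    exact this

/-- The continuation of the Piatetski-Shapiro zeta function for non-integral `α = 1 / κ`. -/
noncomputable def psZeta (α : ℝ) (s : ℂ) : ℂ :=
  -1 / 2 + telescopeSum α ⌈α⌉₊ s + ceilDefectSeries α s

lemma tendsto_natCeil_rpow_mul_cpow {α : ℝ} (hα : 0 < α) {s : ℂ} (hs : α < s.re) :
    Tendsto (fun M : ℕ => (⌈((M + 1 : ℕ) : ℝ) ^ α⌉₊ : ℂ) * ((M : ℂ) + 1) ^ (-s)) atTop
      (nhds 0) := by
  have h1 : Tendsto (fun N : ℕ => 2 * ((N : ℝ) + 1) ^ (-(s.re - α))) atTop (nhds 0) := by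
    have := ((tendsto_rpow_neg_atTop (sub_pos.2 hs)).comp (tendsto_natCast_atTop_atTop.comp
      (tendsto_add_atTop_nat 1))).const_mul 2
    rw [mul_zero] at this
    simpa [Function.comp_def] using this
  refine squeeze_zero_norm (fun M => ?_) h1
  have hM1 : (1 : ℝ) ≤ (M : ℝ) + 1 := by linarith [(Nat.cast_nonneg M : (0 : ℝ) ≤ M)]
  have hM0 : (0 : ℝ) < (M : ℝ) + 1 := by linarith
  have e : (M : ℂ) + 1 = (((M : ℝ) + 1 : ℝ) : ℂ) := by push_cast; rfl
  rw [norm_mul, Complex.norm_natCast, e, Complex.norm_cpow_eq_rpow_re_of_pos hM0, Complex.neg_re]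
  have h2 : (⌈((M + 1 : ℕ) : ℝ) ^ α⌉₊ : ℝ) ≤ 2 * ((M : ℝ) + 1) ^ α := by
    have h3 := Nat.ceil_lt_add_one (a := ((M + 1 : ℕ) : ℝ) ^ α) (by positivity)
    have h4 := Real.one_le_rpow hM1 hα.le
    push_cast at h3 ⊢
    linarith
  calc _ ≤ (2 * ((M : ℝ) + 1) ^ α) * ((M : ℝ) + 1) ^ (-s.re) := by gcongr
    _ = _ := by
      rw [mul_assoc, ← Real.rpow_add hM0]; congr 2; ring

lemma sum_natCeil_sub_mul (α : ℝ) (s : ℂ) (M : ℕ) :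
    ∑ m ∈ range M, ((⌈((m + 2 : ℕ) : ℝ) ^ α⌉₊ : ℂ) - ⌈((m + 1 : ℕ) : ℝ) ^ α⌉₊) *
        ((m : ℂ) + 1) ^ (-s) =
      (⌈((M + 1 : ℕ) : ℝ) ^ α⌉₊ : ℂ) * ((M : ℂ) + 1) ^ (-s) - 1 +
        ∑ n ∈ range M, (⌈((n + 2 : ℕ) : ℝ) ^ α⌉₊ : ℂ) *
          (((n : ℂ) + 1) ^ (-s) - ((n : ℂ) + 2) ^ (-s)) := by
  induction M with
  | zero => simp
  | succ M ih =>
    rw [sum_range_succ, ih, sum_range_succ (fun n => (⌈((n + 2 : ℕ) : ℝ) ^ α⌉₊ : ℂ) * _)]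
    rw [show ((M + 1 : ℕ) : ℂ) + 1 = (M : ℂ) + 2 by push_cast; ring]
    ring

lemma hasSum_psZeta {κ α : ℝ} (hκ : 0 < κ) (hα : α = 1 / κ) (hn : ∀ a : ℕ, α ≠ a) {s : ℂ}
    (hs : 1 / κ < s.re) : HasSum (psZetaTerm κ s) (psZeta α s) := by
  have hα0 : 0 < α := by rw [hα]; positivity
  have hs' : α < s.re := by rwa [hα]
  obtain ⟨σ, hσ0, hσ1, C, hC0, hU⟩ := exists_abs_ceilDefectSum_le hα0 hn
  refine hasSum_psZetaTerm hκ hα hs ?_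
  have h1 := (hasSum_telescopeSum hα0.le ⌈α⌉₊ hs').tendsto_sum_nat
  have h2 := (tendsto_sum_cpow_sub_cpow (hα0.trans hs')).const_mul (1 / 2)
  have h3 := tendsto_sum_ceilDefect_mul hσ0 hσ1 hU hC0 (hα0.trans hs')
  have h4 := ((tendsto_natCeil_rpow_mul_cpow hα0 hs').sub_const 1).add ((h1.add h2).add h3)
  have e : psZeta α s = 0 - 1 + (telescopeSum α ⌈α⌉₊ s + 1 / 2 * 1 + ceilDefectSeries α s) := by
    rw [psZeta]; ring
  rw [e]
  refine h4.congr fun M => ?_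
  rw [sum_natCeil_sub_mul, mul_sum, ← sum_add_distrib, ← sum_add_distrib]
  congr 1
  refine sum_congr rfl fun n _ => ?_
  have := congrArg (fun x : ℝ => (x : ℂ)) (natCeil_rpow_eq α (n + 2))
  push_cast at this ⊢
  rw [this]
  ring

lemma lt_natCeil {α : ℝ} (hn : ∀ a : ℕ, α ≠ a) : α < ⌈α⌉₊ :=
  lt_of_le_of_ne (Nat.le_ceil α) (hn _)

lemma zero_sub_add_natCast_ne_one {α : ℝ} (hα : 0 < α) (hn : ∀ a : ℕ, α ≠ a) {h : ℕ} :
    (0 : ℂ) - α + h ≠ 1 := by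
  intro e
  have e1 : (h : ℝ) - 1 = α := by
    have := congrArg Complex.re e
    simp at this
    linarith
  rcases Nat.eq_zero_or_pos h with rfl | h0
  · rw [Nat.cast_zero] at e1; linarith
  · exact hn (h - 1) (by rw [Nat.cast_sub h0, Nat.cast_one, e1])

lemma analyticAt_ceilDefectSeries {α σ C : ℝ} (hσ1 : σ < 1)
    (hU : ∀ n : ℕ, |ceilDefectSum α (n + 1)| ≤ C * ((n : ℝ) + 1) ^ (1 - σ)) (hC : 0 ≤ C)
    {s : ℂ} (hs : -σ < s.re) : AnalyticAt ℂ (ceilDefectSeries α) s :=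
  isDerivLike_secondDiff.analyticAt_tsum (by linarith : (0 : ℝ) ≤ 1 - σ) hU hC
    (by push_cast; linarith)

/-- The rising factorials that multiply the zeta functions give the binomial residues. -/
lemma risingFactorial_eq_Gamma_div {x : ℝ} (hx : 0 < x) (h : ℕ) :
    risingFactorial (x : ℂ) h = ((Real.Gamma (x + h) / Real.Gamma x : ℝ) : ℂ) := by
  have hΓ : Real.Gamma x ≠ 0 := (Real.Gamma_pos_of_pos hx).ne'
  induction h with
  | zero => simp [risingFactorial, div_self hΓ]
  | succ h ih =>
    have hxh : x + h ≠ 0 := by positivity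
    rw [risingFactorial, prod_range_succ, ← risingFactorial, ih]
    push_cast
    rw [← add_assoc, Real.Gamma_add_one hxh]
    push_cast
    ring

lemma hasSimplePole_psZeta {α σ C : ℝ} (hα : 0 < α) (hn : ∀ a : ℕ, α ≠ a) (hσ0 : 0 < σ)
    (hσ1 : σ < 1) (hU : ∀ n : ℕ, |ceilDefectSum α (n + 1)| ≤ C * ((n : ℝ) + 1) ^ (1 - σ))
    (hC : 0 ≤ C) {h : ℕ} (hh : h < ⌈α⌉₊) :
    HasSimplePoleWithResidue (psZeta α) ((α - h : ℝ) : ℂ)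
      ((Real.Gamma (α + 1) / (((h + 1).factorial : ℝ) * Real.Gamma (α - h)) : ℝ) : ℂ) := by
  have hhα : (h : ℝ) < α := Nat.lt_ceil.1 hh
  have hx : 0 < α - h := by linarith
  set k := ⌈α⌉₊ with hk
  have hαk : α < k := lt_natCeil hn
  set p : ℂ := ((α - h : ℝ) : ℂ) with hp
  have hpre : p.re = α - h := Complex.ofReal_re _
  set c : ℂ → ℂ := fun s => risingFactorial s (h + 1) / (h + 1).factorial with hc
  have hcp : c p =
      ((Real.Gamma (α + 1) / (((h + 1).factorial : ℝ) * Real.Gamma (α - h)) : ℝ) : ℂ) := by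
    simp only [hc, hp]
    rw [risingFactorial_eq_Gamma_div hx]
    push_cast
    rw [show α - h + (h + 1) = α + 1 by ring]
    rw [div_div, mul_comm]
  rw [← hcp]
  have hmem : h + 1 ∈ Icc 1 k := mem_Icc.2 ⟨by omega, hh⟩
  refine hasSimplePoleWithResidue (c := c) (g := fun s => -1 / 2 + ((-c s +
    ∑ i ∈ (Icc 1 k).erase (h + 1),
      risingFactorial s i / i.factorial * (riemannZeta (s - α + i) - 1)) +
    ∑' n : ℕ, ((((n : ℝ) + 2) ^ α : ℝ) : ℂ) * taylorRem (k + 1) s ((n : ℝ) + 2) 1) +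
    ceilDefectSeries α s) ?_ ?_ ?_ ?_
  · exact ((differentiable_risingFactorial (h + 1)).analyticAt p).div_const
  · refine (analyticAt_const.add ((AnalyticAt.add ?_ ?_).add
      (analyticAt_telescopeSum_rem hα.le (by rw [hpre]; linarith)))).add
      (analyticAt_ceilDefectSeries hσ1 hU hC (by rw [hpre]; linarith))
    · exact (((differentiable_risingFactorial (h + 1)).analyticAt p).div_const).neg
    · refine Finset.analyticAt_fun_sum _ fun i hi => analyticAt_telescopeSum_term α ?_
      intro e
      have e1 : ((i : ℕ) : ℂ) = ((h + 1 : ℕ) : ℂ) := by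
        rw [hp] at e
        push_cast at e ⊢
        linear_combination e
      exact (mem_erase.1 hi).1 (by exact_mod_cast e1)
  · rw [hcp]
    have h1 := Real.Gamma_pos_of_pos hx
    have h2 := Real.Gamma_pos_of_pos (by linarith : 0 < α + 1)
    have h3 : 0 < Real.Gamma (α + 1) / (((h + 1).factorial : ℝ) * Real.Gamma (α - h)) := by
      positivity
    exact_mod_cast h3.ne'
  · intro z _
    rw [psZeta, telescopeSum, ← add_sum_erase _ _ hmem]
    have : z - p + 1 = z - α + ((h + 1 : ℕ) : ℂ) := by rw [hp]; push_cast; ring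
    rw [this]
    simp only [hc]
    ring

lemma exists_norm_psZeta_le {α σ C : ℝ} (hα : 0 < α) (hn : ∀ a : ℕ, α ≠ a) (hσ1 : σ < 1)
    (hU : ∀ n : ℕ, |ceilDefectSum α (n + 1)| ≤ C * ((n : ℝ) + 1) ^ (1 - σ)) (hC : 0 ≤ C)
    {σ' : ℝ} (h1 : σ' ≤ σ) (h2 : σ' ≤ ⌈α⌉₊ - α) {ε : ℝ} (hε : 0 < ε) :
    ∃ C' : ℝ, ∀ s : ℂ, ε - σ' ≤ s.re → 1 ≤ |s.im| →
      ‖psZeta α s‖ ≤ C' * (‖s‖ * (‖s‖ + 1) ^ (⌊α⌋₊ + 1)) := by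
  have hfc : ⌊α⌋₊ + 1 = ⌈α⌉₊ := by
    refine (Nat.ceil_eq_iff (by omega)).2 ⟨?_, ?_⟩ |>.symm
    · simpa using lt_of_le_of_ne (Nat.floor_le hα.le) (hn _).symm
    · push_cast; exact (Nat.lt_floor_add_one α).le
  rw [hfc]
  set k := ⌈α⌉₊ with hk
  have hk1 : 1 ≤ k := Nat.one_le_ceil_iff.2 hα
  obtain ⟨A, hA0, hA⟩ := exists_norm_telescopeSum_le hα.le k hε
  obtain ⟨B, hB0, hB⟩ := isDerivLike_secondDiff.exists_norm_tsum_le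
    (by linarith : (0 : ℝ) ≤ 1 - σ) hU hC hε
  refine ⟨1 / 2 + A + B * 9, fun s hs him => ?_⟩
  have hs1 : 1 ≤ ‖s‖ := one_le_norm_of_one_le_abs_im him
  have e1 := hA s (by linarith) him
  have e2 := hB s (by push_cast; linarith)
  have e3 := norm_risingFactorial_le_of_one_le hs1 2
  have e4 : ‖s‖ ^ 2 ≤ ‖s‖ ^ (k + 1) := pow_le_pow_right₀ hs1 (by omega)
  have e5 : 1 ≤ ‖s‖ ^ (k + 1) := one_le_pow₀ hs1
  have e6 : ‖s‖ ^ (k + 1) ≤ ‖s‖ * (‖s‖ + 1) ^ k := by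
    rw [pow_succ']; gcongr; linarith
  have e7 : B * ‖risingFactorial s 2‖ ≤ B * (9 * ‖s‖ ^ (k + 1)) := by
    gcongr
    refine e3.trans ?_
    norm_num
    exact e4
  calc ‖psZeta α s‖ ≤ ‖(-1 / 2 : ℂ)‖ + ‖telescopeSum α k s‖ + ‖ceilDefectSeries α s‖ :=
        norm_add₃_le
    _ ≤ 1 / 2 + A * ‖s‖ ^ (k + 1) + B * (9 * ‖s‖ ^ (k + 1)) := by
        refine add_le_add (add_le_add ?_ e1) (e2.trans e7)
        norm_num
    _ ≤ (1 / 2 + A + B * 9) * ‖s‖ ^ (k + 1) := by nlinarith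
    _ ≤ _ := by gcongr

/-! ### Value and derivative at `0` -/

lemma telescopeSum_at_zero (α : ℝ) (k : ℕ) : telescopeSum α k 0 = 0 := by
  have h1 : ∀ n : ℕ, taylorRem (k + 1) 0 ((n : ℝ) + 2) 1 = 0 := by
    intro n
    rw [taylorRem, sum_range_succ', sum_eq_zero]
    · simp [risingFactorial]
    · intro h _
      rw [risingFactorial_zero_left (by omega)]
      simp
  rw [telescopeSum, sum_eq_zero]
  · simp [h1]
  · intro h hh
    rw [risingFactorial_zero_left (mem_Icc.1 hh).1]
    simp

lemma ceilDefectSeries_at_zero (α : ℝ) : ceilDefectSeries α 0 = 0 := by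
  have : ∀ n, secondDiff n 0 = 0 := fun n => by rw [secondDiff]; norm_num
  simp [ceilDefectSeries, this]

lemma psZeta_zero (α : ℝ) : psZeta α 0 = -1 / 2 := by
  rw [psZeta, telescopeSum_at_zero, ceilDefectSeries_at_zero]
  ring

lemma hasDerivAt_risingFactorial_div {h : ℕ} (hh : 1 ≤ h) :
    HasDerivAt (fun s => risingFactorial s h / h.factorial) (1 / (h : ℂ)) 0 := by
  obtain ⟨h, rfl⟩ := Nat.exists_eq_add_of_le' hh
  have h1 : HasDerivAt (fun s : ℂ => s * risingFactorial (s + 1) h) (h.factorial : ℂ) 0 := by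
    have hd : DifferentiableAt ℂ (fun s : ℂ => risingFactorial (s + 1) h) 0 :=
      ((differentiable_risingFactorial h) _).comp (0 : ℂ) (f := fun s : ℂ => s + 1) (by fun_prop)
    refine ((hasDerivAt_id (0 : ℂ)).mul hd.hasDerivAt).congr_deriv ?_
    simp [risingFactorial_one_left]
  have h2 : (fun s => risingFactorial s (h + 1) / ((h + 1).factorial : ℂ)) =
      fun s : ℂ => s * risingFactorial (s + 1) h / ((h + 1).factorial : ℂ) :=
    funext fun s => by rw [risingFactorial_succ_left]
  rw [h2]
  refine (h1.div_const _).congr_deriv ?_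
  have e1 : ((h.factorial : ℕ) : ℂ) ≠ 0 := by exact_mod_cast h.factorial_ne_zero
  have e2 : ((h : ℂ) + 1) ≠ 0 := by exact_mod_cast h.succ_ne_zero
  rw [Nat.factorial_succ]
  push_cast
  field_simp

lemma hasDerivAt_cpow_neg {x : ℝ} (hx : 0 < x) (c : ℂ) :
    HasDerivAt (fun s : ℂ => (x : ℂ) ^ (-s - c)) (-(Real.log x : ℂ) * (x : ℂ) ^ (-c)) 0 := by
  have hx0 : (x : ℂ) ≠ 0 := by exact_mod_cast hx.ne'
  have h1 : HasDerivAt (fun s : ℂ => -s - c) (-1) 0 := ((hasDerivAt_id (0 : ℂ)).neg).sub_const c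
  refine (h1.const_cpow (Or.inl hx0)).congr_deriv ?_
  rw [Complex.ofReal_log hx.le]
  simp [mul_comm]

lemma deriv_taylorRem_zero (k n : ℕ) :
    deriv (fun s => taylorRem (k + 1) s ((n : ℝ) + 2) 1) 0 =
      ((-(Real.log (1 - 1 / ((n : ℝ) + 2)) +
        ∑ j ∈ Icc 1 k, (1 / ((n : ℝ) + 2)) ^ j / j) : ℝ) : ℂ) := by
  have hn : (0 : ℝ) ≤ n := Nat.cast_nonneg _
  have hx : (0 : ℝ) < (n : ℝ) + 2 := by linarith
  have hx1 : (0 : ℝ) < (n : ℝ) + 1 := by linarith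
  have hIcc : Icc 1 k = Ico (0 + 1) (k + 1) := by ext; simp
  have hfun : (fun s => taylorRem (k + 1) s ((n : ℝ) + 2) 1) = fun s : ℂ =>
      (((n : ℝ) + 1 : ℝ) : ℂ) ^ (-s - 0) - ((((n : ℝ) + 2 : ℝ) : ℂ) ^ (-s - 0) +
        ∑ h ∈ Icc 1 k, risingFactorial s h / h.factorial *
          (((n : ℝ) + 2 : ℝ) : ℂ) ^ (-s - (h : ℂ))) := by
    funext s
    rw [taylorRem, range_eq_Ico, sum_eq_sum_Ico_succ_bot (Nat.succ_pos k), ← hIcc,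
      show (n : ℝ) + 2 - 1 = n + 1 by ring]
    simp [risingFactorial]
  have hd : HasDerivAt (fun s => taylorRem (k + 1) s ((n : ℝ) + 2) 1)
      (-(Real.log ((n : ℝ) + 1) : ℂ) * (((n : ℝ) + 1 : ℝ) : ℂ) ^ (-(0 : ℂ)) -
        (-(Real.log ((n : ℝ) + 2) : ℂ) * (((n : ℝ) + 2 : ℝ) : ℂ) ^ (-(0 : ℂ)) +
          ∑ h ∈ Icc 1 k, 1 / (h : ℂ) * (((n : ℝ) + 2 : ℝ) : ℂ) ^ (-(h : ℂ)))) 0 := by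
    rw [hfun]
    refine (hasDerivAt_cpow_neg hx1 0).sub ((hasDerivAt_cpow_neg hx 0).add
      (HasDerivAt.fun_sum fun h hh => ?_))
    refine ((hasDerivAt_risingFactorial_div (mem_Icc.1 hh).1).mul
      (hasDerivAt_cpow_neg hx h)).congr_deriv ?_
    rw [risingFactorial_zero_left (mem_Icc.1 hh).1]
    simp
  rw [hd.deriv]
  have hlog : Real.log (1 - 1 / ((n : ℝ) + 2)) =
      Real.log ((n : ℝ) + 1) - Real.log ((n : ℝ) + 2) := by
    rw [← Real.log_div hx1.ne' hx.ne']
    congr 1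
    field_simp
    ring
  rw [hlog]
  have hs : ∑ h ∈ Icc 1 k, 1 / (h : ℂ) * (((n : ℝ) + 2 : ℝ) : ℂ) ^ (-(h : ℂ)) =
      ((∑ j ∈ Icc 1 k, (1 / ((n : ℝ) + 2)) ^ j / j : ℝ) : ℂ) := by
    rw [Complex.ofReal_sum]
    refine sum_congr rfl fun j _ => ?_
    rw [Complex.cpow_neg, Complex.cpow_natCast]
    push_cast
    rw [one_div_pow]
    ring
  rw [hs, neg_zero, Complex.cpow_zero, Complex.cpow_zero]
  push_cast
  ring

lemma deriv_secondDiff_zero (n : ℕ) :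
    deriv (secondDiff n) 0 = -((Real.log (1 - 1 / ((n : ℝ) + 2)) : ℝ) : ℂ) -
      -((Real.log (1 - 1 / (((n + 1 : ℕ) : ℝ) + 2)) : ℝ) : ℂ) := by
  have h1 : secondDiff n = fun s => taylorRem (0 + 1) s ((n : ℝ) + 2) 1 -
      taylorRem (0 + 1) s (((n + 1 : ℕ) : ℝ) + 2) 1 := by
    funext s
    rw [zero_add, taylorRem_one, taylorRem_one, secondDiff]
    push_cast
    rw [show (n : ℂ) + 1 + 1 = n + 2 by ring, show (n : ℂ) + 1 + 2 = n + 3 by ring]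
    ring
  have hd := (isDerivLike_taylorRem (0 + 1)).differentiable
  rw [h1]
  rw [deriv_fun_sub ((hd n) 0) ((hd (n + 1)) 0), deriv_taylorRem_zero, deriv_taylorRem_zero]
  simp

lemma bTilde_add_natInd {x : ℝ} (hx : 0 ≤ x) :
    bTilde x + natInd x = -(Int.fract (-x) - 1 / 2) := by
  rw [bTilde, natInd]
  by_cases h : x ∈ Set.range (fun m : ℕ => (m : ℝ))
  · rw [Set.indicator_of_mem h]
    obtain ⟨m, rfl⟩ := h
    have : Int.fract (-(m : ℝ)) = 0 := by
      rw [Int.fract_eq_zero_iff]; exact ⟨-m, by push_cast; rfl⟩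
    simp only [Int.fract_natCast, this]
    norm_num
  · rw [Set.indicator_of_notMem h]
    have hf : Int.fract x ≠ 0 := by
      intro h0
      refine h ⟨⌊x⌋₊, ?_⟩
      show (⌊x⌋₊ : ℝ) = x
      rw [natCast_floor_eq_intCast_floor hx]
      have := Int.floor_add_fract x
      rw [h0] at this
      linarith
    rw [Int.fract_neg hf]
    ring

/-- The terms of the series for the derivative at `0`, as a real combination of logarithms. -/
lemma psLogTerm_eq (α : ℝ) (n : ℕ) :
    psLogTerm α (n + 2) = ((((n : ℝ) + 2) ^ α : ℝ) : ℂ) *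
      deriv (fun s => taylorRem (⌈α⌉₊ + 1) s ((n : ℝ) + 2) 1) 0 +
      (ceilDefect α (n + 2) : ℂ) * -((Real.log (1 - 1 / ((n : ℝ) + 2)) : ℝ) : ℂ) := by
  have hn : (0 : ℝ) ≤ n := Nat.cast_nonneg _
  have hx : (0 : ℝ) < (n : ℝ) + 2 := by linarith
  set y : ℝ := 1 - 1 / ((n : ℝ) + 2) with hy
  have hy0 : 0 < y := by
    rw [hy, sub_pos, div_lt_one hx]; linarith
  have hcast : (((n + 2 : ℕ) : ℕ) : ℝ) = (n : ℝ) + 2 := by push_cast; rfl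
  have hE : ∀ h : ℕ, _root_.canonicalFactor h (1 / ((n + 2 : ℕ) : ℂ)) =
      ((y * Real.exp (∑ j ∈ Icc 1 h, (1 / ((n : ℝ) + 2)) ^ j / j) : ℝ) : ℂ) := by
    intro h
    rw [_root_.canonicalFactor, hy]
    push_cast
    rfl
  have hE0 : _root_.canonicalFactor 0 (1 / ((n + 2 : ℕ) : ℂ)) = ((y : ℝ) : ℂ) := by
    rw [hE]; simp
  have hz0 : 0 < y * Real.exp (∑ j ∈ Icc 1 ⌈α⌉₊, (1 / ((n : ℝ) + 2)) ^ j / j) :=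
    mul_pos hy0 (Real.exp_pos _)
  rw [psLogTerm, hE0, hE, ← Complex.ofReal_cpow hy0.le, ← Complex.ofReal_cpow hz0.le,
    ← Complex.ofReal_div, ← Complex.ofReal_log (by positivity),
    Real.log_div (Real.rpow_pos_of_pos hy0 _).ne' (Real.rpow_pos_of_pos hz0 _).ne',
    Real.log_rpow hy0, Real.log_rpow hz0, Real.log_mul hy0.ne' (Real.exp_pos _).ne', Real.log_exp,
    bTilde_add_natInd (by positivity), deriv_taylorRem_zero, ceilDefect, hcast, ← hy]
  push_cast
  ring

lemma exists_hasDerivAt_psZeta {α : ℝ} (hα : 0 < α) (hn : ∀ a : ℕ, α ≠ a) :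
    ∃ L : ℂ, Tendsto (fun N : ℕ => ∑ n ∈ Icc 2 N, psLogTerm α n) atTop (nhds L) ∧
      HasDerivAt (psZeta α)
        (∑ h ∈ Icc 1 ⌈α⌉₊, (riemannZeta (((h : ℝ) - α : ℝ) : ℂ) - 1) / (h : ℂ) + L) 0 := by
  obtain ⟨σ, hσ0, hσ1, C, hC0, hU⟩ := exists_abs_ceilDefectSum_le hα hn
  have hαk : α < ⌈α⌉₊ := lt_natCeil hn
  set k := ⌈α⌉₊ with hk
  have hre1 : α + 1 - ((k + 1 : ℕ) : ℝ) < (0 : ℂ).re :=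
    (telescopeSum_exponent α k 0).2 (by rw [Complex.zero_re]; linarith)
  have hre2 : 1 - σ + 1 - ((2 : ℕ) : ℝ) < (0 : ℂ).re := by
    rw [Complex.zero_re]; push_cast; linarith
  have d1 := (isDerivLike_taylorRem (k + 1)).differentiableAt_tsum hα.le (abs_add_two_rpow_le hα.le)
    (by positivity) hre1
  have s1 := (isDerivLike_taylorRem (k + 1)).hasSum_deriv hα.le (abs_add_two_rpow_le hα.le)
    (by positivity) hre1
  have d2 := isDerivLike_secondDiff.differentiableAt_tsum (by linarith : (0 : ℝ) ≤ 1 - σ) hU hC0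
    hre2
  have s2 := isDerivLike_secondDiff.hasSum_deriv (by linarith : (0 : ℝ) ≤ 1 - σ) hU hC0 hre2
  set D1 := deriv (fun z => ∑' n : ℕ, ((((n : ℝ) + 2) ^ α : ℝ) : ℂ) *
    taylorRem (k + 1) z ((n : ℝ) + 2) 1) 0 with hD1
  set D2 := deriv (fun z => ∑' n : ℕ, (ceilDefectSum α (n + 1) : ℂ) * secondDiff n z) 0 with hD2
  refine ⟨D1 + D2, ?_, ?_⟩
  · have hb := tendsto_ceilDefectSum_mul (D := 1) (e := 0)
      (d := fun n => -((Real.log (1 - 1 / ((n : ℝ) + 2)) : ℝ) : ℂ)) hU hC0 (fun n => ?_)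
      zero_le_one (by linarith) (by norm_num)
    · have h3 := s1.tendsto_sum_nat.add (s2.tendsto_sum_nat.add hb)
      rw [add_zero] at h3
      rw [← tendsto_add_atTop_iff_nat 1]
      refine h3.congr fun N => ?_
      have h4 : ∑ n ∈ Icc 2 (N + 1), psLogTerm α n = ∑ n ∈ range N, psLogTerm α (n + 2) := by
        have : Icc 2 (N + 1) = Ico 2 (N + 2) := by ext; simp; omega
        rw [this, sum_Ico_eq_sum_range]
        simp [add_comm]
      rw [h4]
      simp only [psLogTerm_eq, sum_add_distrib]
      rw [sum_ceilDefect_mul]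
      simp only [deriv_secondDiff_zero]
      rw [← hk]
    · have hn0 : (0 : ℝ) ≤ n := Nat.cast_nonneg _
      rw [norm_neg, Complex.norm_real, Real.norm_eq_abs, add_zero, Real.rpow_neg_one, one_mul]
      have hx : 1 - 1 / ((n : ℝ) + 2) = ((n : ℝ) + 1) / (n + 2) := by field_simp; ring
      rw [hx, abs_of_nonpos (Real.log_nonpos (by positivity) (by
        rw [div_le_one (by positivity)]; linarith)), ← Real.log_inv, inv_div]
      refine (Real.log_le_sub_one_of_pos (by positivity)).trans (le_of_eq ?_)
      field_simp
      ring
  · have hz : ∀ h ∈ Icc 1 k, HasDerivAt (fun s : ℂ => risingFactorial s h / h.factorial *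
        (riemannZeta (s - α + h) - 1))
        ((riemannZeta (((h : ℝ) - α : ℝ) : ℂ) - 1) / (h : ℂ)) 0 := by
      intro h hh
      have hh1 := (mem_Icc.1 hh).1
      have hd : DifferentiableAt ℂ (fun s : ℂ => riemannZeta (s - α + h) - 1) 0 :=
        ((analyticAt_riemannZeta (zero_sub_add_natCast_ne_one hα hn)).comp
          (f := fun s : ℂ => s - α + h) (by fun_prop)).differentiableAt.sub_const 1
      refine ((hasDerivAt_risingFactorial_div hh1).mul hd.hasDerivAt).congr_deriv ?_
      rw [risingFactorial_zero_left hh1]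
      push_cast
      rw [show (0 : ℂ) - α + h = h - α by ring]
      ring
    have ht := ((HasDerivAt.fun_sum hz).add d1.hasDerivAt).const_add (-1 / 2 : ℂ)
    exact (ht.add d2.hasDerivAt).congr_deriv (by rw [add_assoc])

end PSZeta

/-! ### The Piatetski-Shapiro zeta function -/

theorem proposition1 (κ α : ℝ) (hκ : 0 < κ) (hα : α = 1 / κ) :
    ∃ σ : ℝ, 0 < σ ∧ σ ≤ 1 ∧ ∃ Z : ℂ → ℂ,
      IsPSZetaContinuation κ σ Z ∧
      -- no singularities other than `α, α - 1, …, α + 1 - ⌈α⌉`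
      (∀ s : ℂ, -σ < s.re → (∀ h : ℕ, h < ⌈α⌉₊ → s ≠ ((α - h : ℝ) : ℂ)) → AnalyticAt ℂ Z s) ∧
      -- simple poles with the stated residues at these points
      (∀ h : ℕ, h < ⌈α⌉₊ →
        HasSimplePoleWithResidue Z ((α - h : ℝ) : ℂ)
          ((Real.Gamma (α + 1) / (((h + 1).factorial : ℝ) * Real.Gamma (α - h)) : ℝ) : ℂ)) ∧
      -- polynomial growth
      (∀ ε : ℝ, 0 < ε → ∃ C : ℝ, ∀ s : ℂ, ε - σ ≤ s.re → 1 ≤ |s.im| →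
        ‖Z s‖ ≤ C * (‖s‖ * (‖s‖ + 1) ^ (⌊α⌋₊ + 1))) ∧
      -- the value at `0`
      Z 0 = ((-(1 - natInd α) / 2 - natInd α / (1 + κ) : ℝ) : ℂ) ∧
      -- the derivative at `0`, `α` a positive integer
      (∀ a : ℕ, α = a →
        HasDerivAt Z
          (∑ h ∈ Finset.range a, (a.choose h : ℂ) * deriv riemannZeta (-(h : ℂ))) 0) ∧
      -- the derivative at `0`, `α` not an integer; the series is a limit of partial sums
      ((∀ a : ℕ, α ≠ a) →
        ∃ L : ℂ,
          Filter.Tendsto (fun N : ℕ => ∑ n ∈ Finset.Icc 2 N, psLogTerm α n)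
            Filter.atTop (nhds L) ∧
          HasDerivAt Z
            (∑ h ∈ Finset.Icc 1 ⌈α⌉₊, (riemannZeta (((h : ℝ) - α : ℝ) : ℂ) - 1) / (h : ℂ) + L)
            0) := by
  have hα0 : 0 < α := by rw [hα]; positivity
  -- meromorphy follows from the description of the singularities
  have hmer : ∀ (σ : ℝ) (Z : ℂ → ℂ),
      (∀ s : ℂ, -σ < s.re → (∀ h : ℕ, h < ⌈α⌉₊ → s ≠ ((α - h : ℝ) : ℂ)) → AnalyticAt ℂ Z s) →
      (∀ h : ℕ, h < ⌈α⌉₊ → HasSimplePoleWithResidue Z ((α - h : ℝ) : ℂ)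
          ((Real.Gamma (α + 1) / (((h + 1).factorial : ℝ) * Real.Gamma (α - h)) : ℝ) : ℂ)) →
      MeromorphicOn Z {s : ℂ | -σ < s.re} := by
    intro σ Z h1 h2 s hs
    by_cases h : ∃ h : ℕ, h < ⌈α⌉₊ ∧ s = ((α - h : ℝ) : ℂ)
    · obtain ⟨h, hh, rfl⟩ := h
      exact (h2 h hh).meromorphicAt
    · push Not at h
      exact (h1 s hs h).meromorphicAt
  by_cases hint : ∃ a : ℕ, α = a
  · obtain ⟨a, rfl⟩ := hint
    have han : ∀ s : ℂ, -1 < s.re → (∀ h : ℕ, h < ⌈(a : ℝ)⌉₊ → s ≠ (((a : ℝ) - h : ℝ) : ℂ)) →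
        AnalyticAt ℂ (PSZeta.binomialZeta a) s := by
      intro s _ hs
      refine PSZeta.analyticAt_binomialZeta fun j hj e => ?_
      refine hs (a - 1 - j) (by rw [Nat.ceil_natCast]; omega) ?_
      have e1 : ((a - 1 - j : ℕ) : ℂ) = a - 1 - j := by
        rw [Nat.cast_sub (by omega), Nat.cast_sub (by omega), Nat.cast_one]
      push_cast
      rw [e1]
      linear_combination e
    have hpole : ∀ h : ℕ, h < ⌈(a : ℝ)⌉₊ →
        HasSimplePoleWithResidue (PSZeta.binomialZeta a) (((a : ℝ) - h : ℝ) : ℂ)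
          ((Real.Gamma ((a : ℝ) + 1) / (((h + 1).factorial : ℝ) * Real.Gamma ((a : ℝ) - h)) :
            ℝ) : ℂ) :=
      fun h hh => PSZeta.hasSimplePole_binomialZeta (by rwa [Nat.ceil_natCast] at hh)
    refine ⟨1, one_pos, le_rfl, PSZeta.binomialZeta a,
      ⟨hmer 1 _ han hpole, fun s hs => PSZeta.hasSum_binomialZeta hκ hα hs⟩, han, hpole, ?_, ?_,
      ?_, fun h => absurd rfl (h a)⟩
    · intro ε hε
      rw [Nat.floor_natCast]
      exact PSZeta.exists_norm_binomialZeta_le a hε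
    · have hκa : κ = 1 / a := by rw [hα]; field_simp
      have ha : (a : ℂ) ≠ 0 := by exact_mod_cast hα0.ne'
      have ha1 : (a : ℂ) + 1 ≠ 0 := by exact_mod_cast a.succ_ne_zero
      rw [PSZeta.binomialZeta_zero, PSZeta.natInd_natCast, hκa]
      push_cast
      have ha2 : 1 + 1 / (a : ℂ) ≠ 0 := by
        rw [one_add_div ha]; exact div_ne_zero ha1 ha
      field_simp
      ring
    · intro b hb
      obtain rfl : a = b := by exact_mod_cast hb
      exact PSZeta.hasDerivAt_binomialZeta a
  · push Not at hint
    obtain ⟨σ, hσ0, hσ1, C, hC0, hU⟩ := PSZeta.exists_abs_ceilDefectSum_le hα0 hint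
    have hk := PSZeta.lt_natCeil hint
    -- beyond `⌈α⌉ - α` the next zeta function would contribute a further pole
    set σ' : ℝ := min σ (⌈α⌉₊ - α) with hσ'
    have h1 : σ' ≤ σ := min_le_left _ _
    have h2 : σ' ≤ ⌈α⌉₊ - α := min_le_right _ _
    have han : ∀ s : ℂ, -σ' < s.re → (∀ h : ℕ, h < ⌈α⌉₊ → s ≠ ((α - h : ℝ) : ℂ)) →
        AnalyticAt ℂ (PSZeta.psZeta α) s := by
      intro s hs hne
      refine (analyticAt_const.add (PSZeta.analyticAt_telescopeSum hα0.le (by linarith)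
        fun h hh e => ?_)).add (PSZeta.analyticAt_ceilDefectSeries hσ1 hU hC0 (by linarith))
      rw [Finset.mem_Icc] at hh
      refine hne (h - 1) (by omega) ?_
      push_cast [Nat.cast_sub hh.1]
      linear_combination e
    have hpole := fun h hh =>
      PSZeta.hasSimplePole_psZeta (h := h) hα0 hint hσ0 hσ1 hU hC0 hh
    refine ⟨σ', lt_min hσ0 (by linarith), h1.trans hσ1.le, PSZeta.psZeta α,
      ⟨hmer σ' _ han hpole, fun s hs => PSZeta.hasSum_psZeta hκ hα hint hs⟩, han, hpole,
      fun ε hε => PSZeta.exists_norm_psZeta_le hα0 hint hσ1 hU hC0 h1 h2 hε, ?_,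
      fun a ha => absurd ha (hint a), fun _ => PSZeta.exists_hasDerivAt_psZeta hα0 hint⟩
    have h0 : natInd α = 0 := Set.indicator_of_notMem (by
      rintro ⟨m, hm⟩; exact hint m hm.symm) _
    rw [PSZeta.psZeta_zero, h0]
    push_cast
    ring
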